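/- Let $\Omega\subset\mathbb R^3$ be a bounded Lipschitz open set with outward-pointing unit normal $n$, and let $\mathcal H_0=L^2(\Omega;\mathbb C^3)$, with inner product $(\cdot,\cdot)_{\mathcal H_0}$ linear in the first argument. For $\ell=1,2$ let $\mu_\ell^{-1},\epsilon_\ell:\Omega\to\mathbb C^{3\times3}$ be bounded measurable symmetric matrix functions (symmetric meaning $M^T=M$) with $\operatorname{essinf}_\Omega\Re\mu_\ell^{-1}>0$ and $\operatorname{essinf}_\Omega\Re\epsilon_\ell>0$ in the sense of quadratic forms; denote also by $\mu_\ell^{-1},\epsilon_\ell$ the corresponding multiplication operators on $\mathcal H_0$. For $k>0$ let $\mathcal D:=k^{-1}\operatorname{curl}$. A field $v\in H(\operatorname{curl};\Omega)$ has tangential trace $v_T=g\in L^2(\partial\Omega;\mathbb C^3)$ if $g\cdot n=0$ a.e. on $\partial\Omega$ and $(\operatorname{curl}v,\varphi)_{L^2(\Omega)}-(v,\operatorname{curl}\varphi)_{L^2(\Omega)}=(n\times g,\varphi)_{L^2(\partial\Omega)}$ for all $\varphi\in C_c^\infty(\mathbb R^3;\mathbb C^3)$ (so $v_T=(n\times v)\times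 n$ for smooth $v$). Suppose that one of the following two points holds. (i) (Perfect electric conductor.) $\mathcal H:=H_0(\operatorname{curl};\Omega)=\{v\in H(\operatorname{curl};\Omega):v_T=0\}$, $\|v\|_{\mathcal H}^2:=\|k^{-1}\operatorname{curl}v\|^2_{L^2(\Omega)}+\|v\|^2_{L^2(\Omega)}$, and $b:=0$. (ii) (Impedance.) $\Gamma_{\rm imp}$ is a non-empty connected component of $\partial\Omega$, $$\mathcal H:=\{v\in H(\operatorname{curl};\Omega): v_T=0\text{ on }\partial\Omega\setminus\Gamma_{\rm imp}\text{ and }v_T\in L^2(\Gamma_{\rm imp})\},$$ $$\|v\|_{\mathcal H}^2:=k^{-2}\|\operatorname{curl}v\|^2_{L^2(\Omega)}+\|v\|^2_{L^2(\Omega)}+k^{-1}\|v_T\|^2_{L^2(\Gamma_{\rm imp})},$$ $b(u,v):=-\mathrm i k^{-1}(\theta u_T,v_T)_{L^2(\Gamma_{\rm imp})}$ for some real-valued $\theta\in L^\infty(\Gamma_{\rm imp})$ with $\operatorname{essinf}_{\Gamma_{\rm imp}}\theta>0$, and in addition $\mu_\ell^{-1}$ and $\epsilon_\ell$ are real-valued.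 Then the following abstract assumptions hold. $\mathcal H\subset\mathcal H_0$ are Hilbert spaces ($\mathcal H$ with the inner product that induces $\|\cdot\|_{\mathcal H}$), $\|v\|_{\mathcal H_0}\le\|v\|_{\mathcal H}$ for all $v\in\mathcal H$, and $\mathcal H$ is dense in $\mathcal H_0$ (so that $\mathcal H\subset\mathcal H_0\subset\mathcal H^*$); $\mathcal D:\mathcal H\to\mathcal H_0$ is linear with $\|\mathcal D\|_{\mathcal H\to\mathcal H_0}\le1$; $b$ is a continuous sesquilinear form on $\mathcal H$; $\mu_\ell^{-1},\epsilon_\ell:\mathcal H_0\to\mathcal H_0$ are bounded linear operators; and, with $$a_\ell(u,v):=(\mu_\ell^{-1}\mathcal Du,\mathcal Dv)_{\mathcal H_0}+b(u,v)-(\epsilon_\ell u,v)_{\mathcal H_0},$$ there are $C_{{\rm G1},\ell},C_{{\rm G2},\ell}>0$ such that $$\big|a_\ell(v,v)+C_{{\rm G2},\ell}\|v\|^2_{\mathcal H_0}\big|\ge C_{{\rm G1},\ell}\|v\|^2_{\mathcal H}\quad\text{for all }v\in\mathcal H,\ \ell=1,2.$$ Moreover, for fixed $\Omega,\Gamma_{\rm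 imp},\mu_\ell^{-1},\epsilon_\ell,\theta$, the constants $C_{{\rm G1},\ell},C_{{\rm G2},\ell}$ and the continuity constant of $b$ can be chosen independently of $k>0$. -/

import Mathlib

open MeasureTheory Set Filter Topology
open scoped ContDiff ENNReal Matrix

noncomputable section

/-! ### The abstract framework -/

namespace AbstractWave

/-- `ip` is an inner product on the complex vector space `V` (linear in the first argument,
conjugate-linear in the second one), and `V` is complete for the induced norm. Mathlib's inner
product is conjugate-linear in the first argument, whence the swap of `u` and `v`. -/
def IsHilbertInner {V : Type*} [AddCommGroup V] [Module ℂ V] (ip : V → V → ℂ) : Prop :=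
  ∃ c : InnerProductSpace.Core ℂ V,
    (∀ u v : V, c.inner v u = ip u v) ∧
      (letI : NormedAddCommGroup V := c.toNormedAddCommGroup
       CompleteSpace V)

/-- The norm induced by an inner product. -/
def nrm {V : Type*} (ip : V → V → ℂ) (v : V) : ℝ := √(ip v v).re

variable {H₀ : Type*} [NormedAddCommGroup H₀] [InnerProductSpace ℂ H₀]

/-- The sesquilinear form `a(u,v) = (μ⁻¹ D u, D v) + b(u,v) - (ε u, v)`, where the inner products
are those of `H₀`, linear in the first argument. -/
def sesq {H : Submodule ℂ H₀} (D : H → H₀) (b : H → H → ℂ) (μinv ε : H₀ → H₀) (u v : H) : ℂ :=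
  inner ℂ (D v) (μinv (D u)) + b u v - inner ℂ (v : H₀) (ε (u : H₀))

/-- The abstract assumptions, with continuity constant `Cb` of `b` and with constants
`CG₁ ℓ`, `CG₂ ℓ` in the Gårding-type inequality for `a_ℓ`. The two values of `ℓ : Fin 2` stand for
the two problems. Here `H` is a subspace of the Hilbert space `H₀`, with its own inner product
`ip`. -/
structure AbstractAssumption [CompleteSpace H₀] (H : Submodule ℂ H₀) (ip : H → H → ℂ)
    (D : H → H₀) (b : H → H → ℂ) (μinv ε : Fin 2 → H₀ → H₀)
    (Cb : ℝ) (CG₁ CG₂ : Fin 2 → ℝ) : Prop where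
  /-- `H` is a Hilbert space. -/
  hilbert : IsHilbertInner ip
  norm_le : ∀ v : H, ‖(v : H₀)‖ ≤ nrm ip v
  /-- `H ⊂ H₀ ⊂ H*`: the map `H₀ → H*`, `f ↦ (f, ·)`, is injective exactly when `H` is
  dense in `H₀`. -/
  dense : Dense (H : Set H₀)
  D_linear : IsLinearMap ℂ D
  D_norm_le : ∀ v : H, ‖D v‖ ≤ nrm ip v
  b_add_left : ∀ u u' v : H, b (u + u') v = b u v + b u' v
  b_smul_left : ∀ (c : ℂ) (u v : H), b (c • u) v = c * b u v
  b_add_right : ∀ u v v' : H, b u (v + v') = b u v + b u v'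
  b_smul_right : ∀ (c : ℂ) (u v : H), b u (c • v) = (starRingEnd ℂ) c * b u v
  b_continuous : ∀ u v : H, ‖b u v‖ ≤ Cb * nrm ip u * nrm ip v
  μinv_bounded : ∀ ℓ, IsBoundedLinearMap ℂ (μinv ℓ)
  ε_bounded : ∀ ℓ, IsBoundedLinearMap ℂ (ε ℓ)
  CG₁_pos : ∀ ℓ, 0 < CG₁ ℓ
  CG₂_pos : ∀ ℓ, 0 < CG₂ ℓ
  garding : ∀ (ℓ : Fin 2) (v : H),
    CG₁ ℓ * nrm ip v ^ 2 ≤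
      ‖sesq D b (μinv ℓ) (ε ℓ) v v + ((CG₂ ℓ * ‖(v : H₀)‖ ^ 2 : ℝ) : ℂ)‖

end AbstractWave

/-! ### Maxwell -/

namespace Maxwell

/-- Physical space `ℝ³`. -/
abbrev E3 := EuclideanSpace ℝ (Fin 3)

/-- The space `ℂ³` of values of the fields, with the Hermitian norm. -/
abbrev C3 := EuclideanSpace ℂ (Fin 3)

/-- `Ω` lies, near each of its boundary points and after a rotation of the coordinate axes,
strictly on one side of the graph of a Lipschitz function of two variables. -/
def HasLipschitzBoundary (Ω : Set E3) : Prop :=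
  ∀ x ∈ frontier Ω, ∃ U ∈ 𝓝 x,
    ∃ (e : E3 ≃ₗᵢ[ℝ] WithLp 2 (EuclideanSpace ℝ (Fin 2) × ℝ))
      (f : EuclideanSpace ℝ (Fin 2) → ℝ) (K : NNReal),
      LipschitzWith K f ∧ ∀ y ∈ U, y ∈ Ω ↔ f (e y).fst < (e y).snd

/-- Bounded Lipschitz open subsets of `ℝ³`. -/
structure IsBoundedLipschitzOpen (Ω : Set E3) : Prop where
  isOpen : IsOpen Ω
  isBounded : Bornology.IsBounded Ω
  lipschitz : HasLipschitzBoundary Ω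

/-- `Γ` is a (non-empty) connected component of the boundary of `Ω`. -/
def IsBoundaryComponent (Ω Γ : Set E3) : Prop :=
  ∃ x ∈ frontier Ω, Γ = connectedComponentIn (frontier Ω) x

/-- Surface measure on `∂Ω`. -/
def surf (Ω : Set E3) : Measure E3 := (μHE[2] : Measure E3).restrict (frontier Ω)

/-- `ν` is the outward-pointing unit normal to `Ω` at `x`: up to errors that are `o(|y - x|)` as
`y → x`, one has `(y - x) · ν ≤ 0` for `y ∈ Ω` and `(y - x) · ν ≥ 0` for `y ∉ Ω`. Where `∂Ω` is
locally the graph of `f`, with `Ω` above the graph, this holds for `ν = (∇f, -1) / √(1 + |∇f|²)`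
at the points of differentiability of `f`. At most one vector `ν` has this property. -/
def IsOuterUnitNormal (Ω : Set E3) (x ν : E3) : Prop :=
  ‖ν‖ = 1 ∧ ∀ δ > 0, ∀ᶠ y in 𝓝 x,
    (y ∈ Ω → inner ℝ (y - x) ν ≤ δ * ‖y - x‖) ∧
    (y ∉ Ω → -(δ * ‖y - x‖) ≤ inner ℝ (y - x) ν)

open Classical in
/-- The outward-pointing unit normal field; it is defined at almost every point of the boundary of
a Lipschitz set, and set to zero at the other points. -/
def normal (Ω : Set E3) (x : E3) : E3 :=
  if h : ∃ ν, IsOuterUnitNormal Ω x ν then h.choose else 0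

/-- A real vector as a complex one. -/
def toC (a : E3) : Fin 3 → ℂ := fun i => ((a i : ℝ) : ℂ)

/-- The cross product `a × z`, with `a` real and `z` complex. -/
def cross (a : E3) (z : C3) : C3 := WithLp.toLp 2 (crossProduct (toC a) z.ofLp)

/-- `∂ᵢ φⱼ (x)`. -/
def partialD (φ : E3 → C3) (x : E3) (i j : Fin 3) : ℂ :=
  (fderiv ℝ φ x (EuclideanSpace.single i (1 : ℝ))) j

/-- The classical curl of a differentiable field. -/
def classicalCurl (φ : E3 → C3) (x : E3) : C3 :=
  !₂[partialD φ x 1 2 - partialD φ x 2 1,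
     partialD φ x 2 0 - partialD φ x 0 2,
     partialD φ x 0 1 - partialD φ x 1 0]

/-- Smooth compactly supported fields on `ℝ³` (not necessarily supported in `Ω`). -/
structure IsTestField (φ : E3 → C3) : Prop where
  smooth : ContDiff ℝ ∞ φ
  compact : HasCompactSupport φ

/-- `L²(Ω)`, vector valued. -/
abbrev L2 (Ω : Set E3) := Lp C3 2 (volume.restrict Ω)

/-- `L²(∂Ω)`, vector valued. -/
abbrev L2bd (Ω : Set E3) := Lp C3 2 (surf Ω)

/-- `w` is the weak (distributional) curl of `u` in `Ω`. -/
def HasWeakCurl (Ω : Set E3) (u w : L2 Ω) : Prop :=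
  ∀ φ : E3 → C3, IsTestField φ → tsupport φ ⊆ Ω →
    ∫ x in Ω, inner ℂ (φ x) (w x) = ∫ x in Ω, inner ℂ (classicalCurl φ x) (u x)

/-- `u ∈ H(curl; Ω)` has the tangential trace `u_T = g ∈ L²(∂Ω)`: the field `g` is tangential, and
Green's formula `(curl u, φ)_Ω - (u, curl φ)_Ω = (n × g, φ)_∂Ω` holds for all smooth `φ`. If `u` is
smooth up to the boundary, then `g = (n × u) × n`, for which `n × g = n × u`. (On a Lipschitz set
the integrand over `∂Ω` is always integrable.) -/
def HasTangentialTrace (Ω : Set E3) (u : L2 Ω) (g : L2bd Ω) : Prop :=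
  (∀ᵐ x ∂(surf Ω), toC (normal Ω x) ⬝ᵥ (g x).ofLp = 0) ∧
  ∃ w : L2 Ω, HasWeakCurl Ω u w ∧
    ∀ φ : E3 → C3, IsTestField φ →
      Integrable (fun x => inner ℂ (φ x) (cross (normal Ω x) (g x))) (surf Ω) ∧
      (∫ x in Ω, inner ℂ (φ x) (w x)) - (∫ x in Ω, inner ℂ (classicalCurl φ x) (u x))
        = ∫ x, inner ℂ (φ x) (cross (normal Ω x) (g x)) ∂(surf Ω)

open Classical in
/-- The weak curl of `u` (zero if `u` is not in `H(curl; Ω)`). -/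
def curl (Ω : Set E3) (u : L2 Ω) : L2 Ω :=
  if h : ∃ w, HasWeakCurl Ω u w then h.choose else 0

open Classical in
/-- The tangential trace `u_T` of `u` (zero if `u` has no tangential trace in `L²(∂Ω)`). -/
def tangTrace (Ω : Set E3) (u : L2 Ω) : L2bd Ω :=
  if h : ∃ g, HasTangentialTrace Ω u g then h.choose else 0

/-! Linearity, needed for the energy spaces to be subspaces of `L²(Ω)`. -/

lemma IsTestField.memLp {φ : E3 → C3} (h : IsTestField φ) (Ω : Set E3) :
    MemLp φ 2 (volume.restrict Ω) :=
  h.smooth.continuous.memLp_of_hasCompactSupport h.compact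

lemma IsTestField.memLp_curl {φ : E3 → C3} (h : IsTestField φ) (Ω : Set E3) :
    MemLp (classicalCurl φ) 2 (volume.restrict Ω) := by
  have hd : Continuous (fderiv ℝ φ) := h.smooth.continuous_fderiv (by simp)
  have hp : ∀ i j, Continuous (fun x => partialD φ x i j) := by
    intro i j
    unfold partialD
    have h1 : Continuous fun x => fderiv ℝ φ x (EuclideanSpace.single i (1 : ℝ)) :=
      hd.clm_apply continuous_const
    exact (EuclideanSpace.proj (𝕜 := ℂ) j).continuous.comp h1
  have hc : Continuous (classicalCurl φ) := by
    unfold classicalCurl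
    refine (PiLp.continuous_toLp 2 _).comp (continuous_pi fun i => ?_)
    fin_cases i
    · exact (hp 1 2).sub (hp 2 1)
    · exact (hp 2 0).sub (hp 0 2)
    · exact (hp 0 1).sub (hp 1 0)
  refine hc.memLp_of_hasCompactSupport ?_
  refine (h.compact.fderiv (𝕜 := ℝ)).mono' ?_
  intro x hx
  by_contra hx'
  apply hx
  have h0 : fderiv ℝ φ x = 0 := by
    by_contra hne
    exact hx' (subset_closure hne)
  ext i
  fin_cases i <;> simp [classicalCurl, partialD, h0]

lemma integrable_inner {Ω : Set E3} {φ : E3 → C3} (h : MemLp φ 2 (volume.restrict Ω)) (u : L2 Ω) :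
    Integrable (fun x => inner ℂ (φ x) (u x)) (volume.restrict Ω) :=
  (L2.integrable_inner (𝕜 := ℂ) (h.toLp φ) u).congr
    (h.coeFn_toLp.mono fun x hx => by simp only [hx])

lemma integral_inner_add {Ω : Set E3} {φ : E3 → C3} (h : MemLp φ 2 (volume.restrict Ω))
    (u v : L2 Ω) :
    ∫ x in Ω, inner ℂ (φ x) ((u + v : L2 Ω) x)
      = (∫ x in Ω, inner ℂ (φ x) (u x)) + (∫ x in Ω, inner ℂ (φ x) (v x)) := by
  rw [← integral_add (integrable_inner h u) (integrable_inner h v)]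
  refine integral_congr_ae ?_
  filter_upwards [Lp.coeFn_add u v] with x hx
  rw [hx, Pi.add_apply, inner_add_right]

lemma integral_inner_smul {Ω : Set E3} (φ : E3 → C3) (c : ℂ) (u : L2 Ω) :
    ∫ x in Ω, inner ℂ (φ x) ((c • u : L2 Ω) x) = c * ∫ x in Ω, inner ℂ (φ x) (u x) := by
  rw [← integral_const_mul]
  refine integral_congr_ae ?_
  filter_upwards [Lp.coeFn_smul c u] with x hx
  rw [hx, Pi.smul_apply, inner_smul_right]

lemma cross_add (a : E3) (y z : C3) : cross a (y + z) = cross a y + cross a z := by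
  simp [cross]

lemma cross_smul (a : E3) (c : ℂ) (z : C3) : cross a (c • z) = c • cross a z := by
  simp [cross]

lemma HasWeakCurl.add {Ω : Set E3} {u v w z : L2 Ω} (h : HasWeakCurl Ω u w)
    (h' : HasWeakCurl Ω v z) : HasWeakCurl Ω (u + v) (w + z) := fun φ hφ hs => by
  rw [integral_inner_add (hφ.memLp Ω), integral_inner_add (hφ.memLp_curl Ω), h φ hφ hs,
    h' φ hφ hs]

lemma HasWeakCurl.smul {Ω : Set E3} {u w : L2 Ω} (c : ℂ) (h : HasWeakCurl Ω u w) :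
    HasWeakCurl Ω (c • u) (c • w) := fun φ hφ hs => by
  rw [integral_inner_smul, integral_inner_smul, h φ hφ hs]

lemma HasTangentialTrace.add {Ω : Set E3} {u v : L2 Ω} {g g' : L2bd Ω}
    (h : HasTangentialTrace Ω u g) (h' : HasTangentialTrace Ω v g') :
    HasTangentialTrace Ω (u + v) (g + g') := by
  obtain ⟨ht, w, hw, hi⟩ := h
  obtain ⟨ht', w', hw', hi'⟩ := h'
  refine ⟨?_, w + w', hw.add hw', fun φ hφ => ?_⟩
  · filter_upwards [ht, ht', Lp.coeFn_add g g'] with x h1 h2 h3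
    rw [h3, Pi.add_apply, WithLp.ofLp_add, dotProduct_add, h1, h2, add_zero]
  · have e : (fun x => inner ℂ (φ x) (cross (normal Ω x) ((g + g' : L2bd Ω) x)))
        =ᵐ[surf Ω] (fun x => inner ℂ (φ x) (cross (normal Ω x) (g x)))
          + (fun x => inner ℂ (φ x) (cross (normal Ω x) (g' x))) := by
      filter_upwards [Lp.coeFn_add g g'] with x hx
      rw [hx, Pi.add_apply, cross_add, inner_add_right, Pi.add_apply]
    obtain ⟨hi1, hi2⟩ := hi φ hφ
    obtain ⟨hi1', hi2'⟩ := hi' φ hφ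
    refine ⟨(hi1.add hi1').congr e.symm, ?_⟩
    rw [integral_congr_ae e, integral_add' hi1 hi1', integral_inner_add (hφ.memLp Ω),
      integral_inner_add (hφ.memLp_curl Ω), ← hi2, ← hi2']
    ring

lemma HasTangentialTrace.smul {Ω : Set E3} {u : L2 Ω} {g : L2bd Ω} (c : ℂ)
    (h : HasTangentialTrace Ω u g) : HasTangentialTrace Ω (c • u) (c • g) := by
  obtain ⟨ht, w, hw, hi⟩ := h
  refine ⟨?_, c • w, hw.smul c, fun φ hφ => ?_⟩
  · filter_upwards [ht, Lp.coeFn_smul c g] with x h1 h3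
    rw [h3, Pi.smul_apply, WithLp.ofLp_smul, dotProduct_smul, h1, smul_zero]
  · have e : (fun x => inner ℂ (φ x) (cross (normal Ω x) ((c • g : L2bd Ω) x)))
        =ᵐ[surf Ω] (fun x => c * inner ℂ (φ x) (cross (normal Ω x) (g x))) := by
      filter_upwards [Lp.coeFn_smul c g] with x hx
      rw [hx, Pi.smul_apply, cross_smul, inner_smul_right]
    obtain ⟨hi1, hi2⟩ := hi φ hφ
    refine ⟨(hi1.const_mul c).congr e.symm, ?_⟩
    rw [integral_congr_ae e, integral_const_mul, integral_inner_smul, integral_inner_smul, ← hi2]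
    ring

lemma HasTangentialTrace.zero (Ω : Set E3) : HasTangentialTrace Ω 0 0 := by
  have z : ∀ φ : E3 → C3, ∫ x in Ω, inner ℂ (φ x) ((0 : L2 Ω) x) = 0 := fun φ => by
    simpa using integral_inner_smul (Ω := Ω) φ 0 0
  have e : ∀ φ : E3 → C3, (fun x => inner ℂ (φ x) (cross (normal Ω x) ((0 : L2bd Ω) x)))
        =ᵐ[surf Ω] (fun _ => (0 : ℂ)) := fun φ => by
    filter_upwards [Lp.coeFn_zero C3 2 (surf Ω)] with x hx
    rw [hx]
    simp [cross]
  refine ⟨?_, 0, fun φ _ _ => by rw [z, z], fun φ _ => ⟨?_, ?_⟩⟩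
  · filter_upwards [Lp.coeFn_zero C3 2 (surf Ω)] with x hx
    rw [hx]
    simp
  · exact (integrable_zero _ _ _).congr (e φ).symm
  · rw [integral_congr_ae (e φ), z, z]
    simp

/-- `H₀(curl; Ω) = {v ∈ H(curl; Ω) : v_T = 0}`, as a subspace of `L²(Ω)`. -/
def HPEC (Ω : Set E3) : Submodule ℂ (L2 Ω) where
  carrier := {v | HasTangentialTrace Ω v 0}
  zero_mem' := HasTangentialTrace.zero Ω
  add_mem' := fun h h' => by simpa using HasTangentialTrace.add h h'
  smul_mem' := fun c _ h => by simpa using HasTangentialTrace.smul c h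

/-- The space of all `v ∈ H(curl; Ω)` with `v_T = 0` on `∂Ω ∖ Γ` and `v_T ∈ L²(Γ)`, as a subspace
of `L²(Ω)`. -/
def Himp (Ω Γ : Set E3) : Submodule ℂ (L2 Ω) where
  carrier := {v | ∃ g : L2bd Ω, HasTangentialTrace Ω v g ∧
    ∀ᵐ x ∂((surf Ω).restrict Γᶜ), g x = 0}
  zero_mem' := ⟨0, HasTangentialTrace.zero Ω,
    ae_restrict_of_ae ((Lp.coeFn_zero C3 2 (surf Ω)).mono fun x hx => by simpa using hx)⟩
  add_mem' := by
    rintro u v ⟨g, hg, h0⟩ ⟨g', hg', h0'⟩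
    refine ⟨g + g', hg.add hg', ?_⟩
    filter_upwards [h0, h0', ae_restrict_of_ae (Lp.coeFn_add g g')] with x h1 h2 h3
    rw [h3, Pi.add_apply, h1, h2, add_zero]
  smul_mem' := by
    rintro c u ⟨g, hg, h0⟩
    refine ⟨c • g, hg.smul c, ?_⟩
    filter_upwards [h0, ae_restrict_of_ae (Lp.coeFn_smul c g)] with x h1 h3
    rw [h3, Pi.smul_apply, h1, smul_zero]

/-- The operator `D = k⁻¹ curl`. -/
def Dcurl (Ω : Set E3) (k : ℝ) (H : Submodule ℂ (L2 Ω)) (v : H) : L2 Ω :=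
  ((k⁻¹ : ℝ) : ℂ) • curl Ω (v : L2 Ω)

/-- The inner product of `H₀(curl; Ω)`, with norm `‖k⁻¹ curl v‖² + ‖v‖²`. -/
def ipPEC (Ω : Set E3) (k : ℝ) (u v : HPEC Ω) : ℂ :=
  inner ℂ (Dcurl Ω k _ v) (Dcurl Ω k _ u) + inner ℂ (v : L2 Ω) (u : L2 Ω)

/-- The inner product of the impedance space, with norm
`k⁻² ‖curl v‖² + ‖v‖² + k⁻¹ ‖v_T‖²_Γ`. -/
def ipImp (Ω Γ : Set E3) (k : ℝ) (u v : Himp Ω Γ) : ℂ :=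
  ((k⁻¹ ^ 2 : ℝ) : ℂ) * inner ℂ (curl Ω (v : L2 Ω)) (curl Ω (u : L2 Ω))
    + inner ℂ (v : L2 Ω) (u : L2 Ω)
    + ((k⁻¹ : ℝ) : ℂ) *
      ∫ x in Γ, inner ℂ (tangTrace Ω (v : L2 Ω) x) (tangTrace Ω (u : L2 Ω) x) ∂(surf Ω)

/-- `b(u,v) = - i k⁻¹ (θ u_T, v_T)_{L²(Γ)}`. -/
def bImp (Ω Γ : Set E3) (k : ℝ) (θ : E3 → ℝ) (u v : Himp Ω Γ) : ℂ :=
  -Complex.I * ((k⁻¹ : ℝ) : ℂ) *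
    ∫ x in Γ, (θ x : ℂ) *
      inner ℂ (tangTrace Ω (v : L2 Ω) x) (tangTrace Ω (u : L2 Ω) x) ∂(surf Ω)

open Classical in
/-- Multiplication by the matrix function `M` on `L²(Ω)` (for a bounded measurable `M` the product
is always in `L²(Ω)`). -/
def mulOp (Ω : Set E3) (M : E3 → Matrix (Fin 3) (Fin 3) ℂ) (u : L2 Ω) : L2 Ω :=
  if h : MemLp (fun x => (WithLp.toLp 2 (M x *ᵥ (u x).ofLp) : C3)) 2 (volume.restrict Ω)
  then h.toLp _ else 0

/-- `M` is a (measurable) bounded, symmetric, complex matrix function on `Ω` with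
`essinf Re M > 0` in the sense of quadratic forms. Symmetric means `Mᵀ = M`, so `M` need not be
Hermitian. -/
structure IsCoefficient (Ω : Set E3) (M : E3 → Matrix (Fin 3) (Fin 3) ℂ) : Prop where
  bounded : ∀ i j, MemLp (fun x => M x i j) ∞ (volume.restrict Ω)
  symm : ∀ᵐ x ∂(volume.restrict Ω), (M x).IsSymm
  pos : ∃ c : ℝ, 0 < c ∧ ∀ᵐ x ∂(volume.restrict Ω), ∀ ξ : Fin 3 → ℂ,
    c * ∑ i, ‖ξ i‖ ^ 2 ≤ (star ξ ⬝ᵥ (M x *ᵥ ξ)).re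

/-- `M` is real-valued almost everywhere in `Ω`. -/
def IsRealValued (Ω : Set E3) (M : E3 → Matrix (Fin 3) (Fin 3) ℂ) : Prop :=
  ∀ᵐ x ∂(volume.restrict Ω), ∀ i j, (M x i j).im = 0

end Maxwell

end

noncomputable section

namespace Maxwell

/-! ### The boundary of a Lipschitz set -/

/-! In both problems the norm of `H` is the graph norm of `v ↦ (D v, v, τ v)`, where `τ` is `0`
(PEC) or `k^(-1/2)` times the tangential trace (impedance), and `b(u,v) = -i (Θ τ u, τ v)` with `Θ`
multiplication by `θ` on `Γ`. The wavenumber enters only through `D` and `τ`, so constants expressed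
by `Θ`, `ε` and the lower bounds of `μ⁻¹` and `θ` do not depend on it
(`AbstractAssumption.of_graph`).

Gårding inequality. For PEC, take real parts: `μ⁻¹` bounds `‖D v‖²` from below, and the shift `‖ε‖ +
c` absorbs the `ε` term and leaves `c ‖v‖²`. For impedance, real symmetric coefficients are
Hermitian, so the volume terms are real while `b(v,v)` is purely imaginary. The real part controls
`‖D v‖² + ‖v‖²`, the imaginary part controls `‖τ v‖²`, and the modulus dominates half their sum.

Completeness amounts to closedness of `(D, τ)`: the weak curl and Green's formula are identities
against fixed test fields and survive `L²` limits (`HasTangentialTrace.of_tendsto`). Density holds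
because test fields supported in `Ω` have zero trace.

For curl and trace to be linear maps they must be unique. For the trace, Green's formula determines
`n × g`, which determines a tangential `g` wherever `|n| = 1`. That this holds almost everywhere on
`∂Ω` is Rademacher's theorem in graph charts; the charts also show that `∂Ω` has finite area, so
that `L²(∂Ω) ⊂ L¹(∂Ω)`. -/

lemma euclideanHausdorffMeasure_image_le {X : Type*} [EMetricSpace X] [MeasurableSpace X]
    [BorelSpace X] {d : ℕ} {G : EuclideanSpace ℝ (Fin d) → X} {C : NNReal}
    (hG : LipschitzWith C G) (s : Set (EuclideanSpace ℝ (Fin d))) :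
    (μHE[d] : Measure X) (G '' s) ≤ (C : ℝ≥0∞) ^ (d : ℝ) * volume s := by
  rw [← EuclideanSpace.euclideanHausdorffMeasure_eq_volume,
    Measure.euclideanHausdorffMeasure_def, Measure.euclideanHausdorffMeasure_def,
    Measure.smul_apply, Measure.smul_apply, ENNReal.smul_def, ENNReal.smul_def, smul_eq_mul,
    smul_eq_mul, mul_left_comm]
  gcongr
  exact hG.hausdorffMeasure_image_le (by positivity) s

/-- A chart of the boundary. -/
structure IsBoundaryChart (Ω U : Set E3)
    (e : E3 ≃ₗᵢ[ℝ] WithLp 2 (EuclideanSpace ℝ (Fin 2) × ℝ))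
    (f : EuclideanSpace ℝ (Fin 2) → ℝ) : Prop where
  isOpen : IsOpen U
  isBounded : Bornology.IsBounded U
  lipschitz : ∃ K, LipschitzWith K f
  mem_iff : ∀ y ∈ U, y ∈ Ω ↔ f (e y).fst < (e y).snd

lemma HasLipschitzBoundary.exists_chart {Ω : Set E3} (h : HasLipschitzBoundary Ω) {x : E3}
    (hx : x ∈ frontier Ω) : ∃ U e f, x ∈ U ∧ IsBoundaryChart Ω U e f := by
  obtain ⟨U, hU, e, f, K, hf, hy⟩ := h x hx
  exact ⟨interior U ∩ Metric.ball x 1, e, f,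
    ⟨mem_interior_iff_mem_nhds.2 hU, Metric.mem_ball_self one_pos⟩,
    isOpen_interior.inter Metric.isOpen_ball, Metric.isBounded_ball.subset inter_subset_right,
    ⟨K, hf⟩, fun y hyU => hy y (interior_subset hyU.1)⟩

namespace IsBoundaryChart

variable {Ω U : Set E3} {e : E3 ≃ₗᵢ[ℝ] WithLp 2 (EuclideanSpace ℝ (Fin 2) × ℝ)}
  {f : EuclideanSpace ℝ (Fin 2) → ℝ}

/-- Either strict inequality is an open condition: above the graph, `y` would be interior to `Ω`;
below it, `y` would have a neighbourhood that misses `Ω`. -/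
lemma snd_eq (h : IsBoundaryChart Ω U e f) {y : E3} (hy : y ∈ frontier Ω) (hyU : y ∈ U) :
    (e y).snd = f (e y).fst := by
  obtain ⟨K, hK⟩ := h.lipschitz
  have c1 : Continuous fun z => (e z).snd :=
    (WithLp.sndL 2 ℝ (EuclideanSpace ℝ (Fin 2)) ℝ).continuous.comp e.continuous
  have c2 : Continuous fun z => f (e z).fst :=
    hK.continuous.comp ((WithLp.fstL 2 ℝ (EuclideanSpace ℝ (Fin 2)) ℝ).continuous.comp
      e.continuous)
  have hn : U ∈ 𝓝 y := h.isOpen.mem_nhds hyU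
  refine le_antisymm ?_ ?_
  · by_contra! hlt
    refine hy.2 (mem_interior_iff_mem_nhds.2 ?_)
    filter_upwards [hn, (isOpen_lt c2 c1).mem_nhds hlt] with z hz hz'
    exact (h.mem_iff z hz).2 hz'
  · by_contra! hlt
    have hc : y ∈ closure Ω := hy.1
    obtain ⟨z, hz, hzΩ⟩ := mem_closure_iff_nhds.1 hc _
      (inter_mem hn ((isOpen_lt c1 c2).mem_nhds hlt))
    exact lt_asymm hz.2 ((h.mem_iff z hz.1).1 hzΩ)

/-- The parametrization of the boundary by the graph of `f`. -/
def param (e : E3 ≃ₗᵢ[ℝ] WithLp 2 (EuclideanSpace ℝ (Fin 2) × ℝ))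
    (f : EuclideanSpace ℝ (Fin 2) → ℝ) (p : EuclideanSpace ℝ (Fin 2)) : E3 :=
  e.symm (WithLp.toLp 2 (p, f p))

lemma lipschitz_param (h : IsBoundaryChart Ω U e f) : ∃ C, LipschitzWith C (param e f) := by
  obtain ⟨K, hK⟩ := h.lipschitz
  exact ⟨_, e.symm.isometry.lipschitz.comp
    ((WithLp.prod_lipschitzWith_toLp 2 _ _).comp (LipschitzWith.id.prodMk hK))⟩

lemma param_fst (h : IsBoundaryChart Ω U e f) {y : E3} (hy : y ∈ frontier Ω) (hyU : y ∈ U) :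
    param e f (e y).fst = y := by
  rw [param, ← h.snd_eq hy hyU]
  exact e.symm_apply_apply y

lemma measure_lt_top (h : IsBoundaryChart Ω U e f) :
    (μHE[2] : Measure E3) (frontier Ω ∩ U) < ⊤ := by
  obtain ⟨C, hC⟩ := h.lipschitz_param
  set s := (fun y : E3 => (e y).fst) '' U
  have hs : Bornology.IsBounded s :=
    ((WithLp.fstL 2 ℝ (EuclideanSpace ℝ (Fin 2)) ℝ).lipschitz.comp
      e.isometry.lipschitz).isBounded_image h.isBounded
  have hsub : frontier Ω ∩ U ⊆ param e f '' s := fun y hy =>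
    ⟨_, mem_image_of_mem _ hy.2, h.param_fst hy.1 hy.2⟩
  refine (measure_mono hsub).trans_lt ((euclideanHausdorffMeasure_image_le hC s).trans_lt ?_)
  exact ENNReal.mul_lt_top (ENNReal.rpow_lt_top_of_nonneg (by positivity) (by simp)) hs.measure_lt_top

/-- Differentiability of `f` makes `Ω` a half-space near `x` up to `o(|y - x|)`; its outer normal is
the normalized `(∇f, -1)`. -/
lemma isOuterUnitNormal (h : IsBoundaryChart Ω U e f) {x : E3} (hx : x ∈ frontier Ω) (hxU : x ∈ U)
    (hf : DifferentiableAt ℝ f (e x).fst) : ∃ ν, IsOuterUnitNormal Ω x ν := by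
  set p := (e x).fst
  set g := gradient f p
  have hg : HasGradientAt f g p := hf.hasGradientAt
  set N : WithLp 2 (EuclideanSpace ℝ (Fin 2) × ℝ) := WithLp.toLp 2 (g, -1)
  have hN : 0 < ‖N‖ := by
    refine norm_pos_iff.2 fun h0 => ?_
    have := congrArg (fun z => z.snd) h0
    simp [N] at this
  have hin : ∀ y, inner ℝ (y - x) (e.symm (‖N‖⁻¹ • N)) =
      ‖N‖⁻¹ * (inner ℝ g ((e y).fst - p) - ((e y).snd - f p)) := by
    intro y
    rw [← e.inner_map_map, e.apply_symm_apply, inner_smul_right, WithLp.prod_inner_apply]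
    congr 1
    rw [← h.snd_eq hx hxU, real_inner_comm]
    simp [N, p, sub_eq_add_neg]
  refine ⟨e.symm (‖N‖⁻¹ • N), ?_, fun δ hδ => ?_⟩
  · rw [e.symm.norm_map, norm_smul, norm_inv, norm_norm, inv_mul_cancel₀ hN.ne']
  -- The tolerance `δ ‖N‖` compensates the factor `‖N‖⁻¹` from normalizing `N`.
  have ho := hg.hasFDerivAt.isLittleO.def (mul_pos hδ hN)
  have hcont : Tendsto (fun y : E3 => (e y).fst) (𝓝 x) (𝓝 p) :=
    ((WithLp.fstL 2 ℝ (EuclideanSpace ℝ (Fin 2)) ℝ).continuous.comp e.continuous).tendsto x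
  filter_upwards [hcont.eventually ho, h.isOpen.mem_nhds hxU] with y hy hyU
  have hfst : ‖(e y).fst - p‖ ≤ ‖y - x‖ := by
    have h1 : (e y).fst - p = (e (y - x)).fst := by simp [p]
    rw [h1, ← e.norm_map (y - x)]
    exact WithLp.norm_fst_le (x := e (y - x)) (p := 2)
  have key : |f (e y).fst - f p - inner ℝ g ((e y).fst - p)| ≤ ‖N‖ * (δ * ‖y - x‖) := by
    have h2 : f (e y).fst - f p - inner ℝ g ((e y).fst - p) =
        f (e y).fst - f p - (InnerProductSpace.toDual ℝ _ g) ((e y).fst - p) := by simp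
    rw [h2, ← Real.norm_eq_abs]
    refine hy.trans ?_
    calc δ * ‖N‖ * ‖(e y).fst - p‖ ≤ δ * ‖N‖ * ‖y - x‖ := by gcongr
      _ = _ := by ring
  obtain ⟨k1, k2⟩ := abs_le.1 key
  rw [hin y, h.mem_iff y hyU, inv_mul_le_iff₀ hN, le_inv_mul_iff₀ hN]
  refine ⟨fun hlt => by linarith, fun hlt => by linarith [not_lt.1 hlt]⟩

end IsBoundaryChart

lemma IsBoundedLipschitzOpen.isCompact_frontier {Ω : Set E3} (h : IsBoundedLipschitzOpen Ω) :
    IsCompact (frontier Ω) :=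
  Metric.isCompact_of_isClosed_isBounded isClosed_frontier
    (h.isBounded.closure.subset frontier_subset_closure)

lemma IsBoundedLipschitzOpen.isFiniteMeasure_surf {Ω : Set E3} (h : IsBoundedLipschitzOpen Ω) :
    IsFiniteMeasure (surf Ω) := by
  refine ⟨?_⟩
  rw [surf, Measure.restrict_apply_univ]
  refine h.isCompact_frontier.measure_lt_top_of_nhdsWithin fun x hx => ?_
  obtain ⟨U, e, f, hxU, hc⟩ := h.lipschitz.exists_chart hx
  exact ⟨frontier Ω ∩ U, inter_mem_nhdsWithin _ (hc.isOpen.mem_nhds hxU), hc.measure_lt_top⟩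

/-- By Rademacher, `f` is differentiable off a null set of the plane. The Lipschitz parametrization
maps that set to a null set of the boundary, and locally only these points can lack a normal. -/
lemma IsBoundedLipschitzOpen.ae_exists_normal {Ω : Set E3} (h : IsBoundedLipschitzOpen Ω) :
    ∀ᵐ x ∂(surf Ω), ∃ ν, IsOuterUnitNormal Ω x ν := by
  rw [surf, ae_restrict_iff' isClosed_frontier.measurableSet, ae_iff]
  refine measure_null_of_locally_null _ fun x hx => ?_
  obtain ⟨hx1, -⟩ : x ∈ frontier Ω ∧ _ := by simpa only [mem_ofPred_eq, Classical.not_imp] using hx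
  obtain ⟨U, e, f, hxU, hc⟩ := h.lipschitz.exists_chart hx1
  refine ⟨_, inter_mem_nhdsWithin _ (hc.isOpen.mem_nhds hxU), ?_⟩
  obtain ⟨K, hK⟩ := hc.lipschitz
  obtain ⟨C, hC⟩ := hc.lipschitz_param
  set s := {p | ¬ DifferentiableAt ℝ f p}
  have hs : volume s = 0 := hK.ae_differentiableAt
  refine measure_mono_null (t := IsBoundaryChart.param e f '' s) ?_
    (le_antisymm ((euclideanHausdorffMeasure_image_le hC s).trans (by simp [hs])) zero_le)
  rintro y ⟨hy, hyU⟩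
  obtain ⟨hy1, hy2⟩ : y ∈ frontier Ω ∧ _ := by
    simpa only [mem_ofPred_eq, Classical.not_imp] using hy
  exact ⟨(e y).fst, fun hd => hy2 (hc.isOuterUnitNormal hy1 hyU hd), hc.param_fst hy1 hyU⟩

lemma IsBoundaryComponent.isClosed {Ω Γ : Set E3} (h : IsBoundaryComponent Ω Γ) : IsClosed Γ := by
  obtain ⟨x, hx, rfl⟩ := h
  rw [connectedComponentIn_eq_image hx]
  exact isClosed_frontier.isClosedEmbedding_subtypeVal.isClosedMap _ isClosed_connectedComponent

/-- The default value zero makes this bound valid at every point, not only almost everywhere. -/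
lemma norm_normal_le (Ω : Set E3) (x : E3) : ‖normal Ω x‖ ≤ 1 := by
  unfold normal
  split_ifs with h
  · exact h.choose_spec.1.le
  · simp

lemma IsBoundedLipschitzOpen.ae_norm_normal {Ω : Set E3} (h : IsBoundedLipschitzOpen Ω) :
    ∀ᵐ x ∂(surf Ω), ‖normal Ω x‖ = 1 := by
  filter_upwards [h.ae_exists_normal] with x hx
  rw [normal, dif_pos hx]
  exact hx.choose_spec.1

end Maxwell

namespace Maxwell

/-! ### The cross product -/

/-- Lagrange's identity. The dot product is bilinear, without conjugation; since `a` is real, it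
agrees with the Hermitian product. -/
lemma norm_cross_sq_add (a : E3) (z : C3) :
    ‖cross a z‖ ^ 2 + ‖toC a ⬝ᵥ z.ofLp‖ ^ 2 = ‖a‖ ^ 2 * ‖z‖ ^ 2 := by
  simp only [cross, toC, EuclideanSpace.norm_sq_eq, Fin.sum_univ_three, cross_apply,
    dotProduct, Complex.sq_norm, Complex.normSq_apply, Real.norm_eq_abs, sq_abs]
  simp
  ring

lemma norm_cross_le (a : E3) (z : C3) : ‖cross a z‖ ≤ ‖a‖ * ‖z‖ := by
  refine le_of_sq_le_sq ?_ (by positivity)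
  rw [mul_pow, ← norm_cross_sq_add]
  exact le_add_of_nonneg_right (by positivity)

lemma eq_zero_of_cross_eq_zero {a : E3} {z : C3} (ha : ‖a‖ = 1) (h : cross a z = 0)
    (h' : toC a ⬝ᵥ z.ofLp = 0) : z = 0 := by
  have := norm_cross_sq_add a z
  rw [h, h', ha] at this
  simpa using this.symm

lemma cross_sub (a : E3) (y z : C3) : cross a (y - z) = cross a y - cross a z := by
  simp [cross]

lemma continuous_cross (a : E3) : Continuous (cross a) :=
  LinearMap.continuous_of_finiteDimensional
    ({ toFun := cross a, map_add' := cross_add a, map_smul' := cross_smul a } : C3 →ₗ[ℂ] C3)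

/-! ### Test fields -/

/-- The `i`-th coordinate of a vector of `ℂ³`. -/
def coord (i : Fin 3) : C3 →L[ℂ] ℂ := EuclideanSpace.proj i

lemma IsTestField.of_real_smul {g : E3 → ℝ} (hg : ContDiff ℝ ∞ g) (hc : HasCompactSupport g)
    (c : C3) : IsTestField fun x => g x • c :=
  ⟨hg.smul contDiff_const, hc.smul_right⟩

lemma tsupport_real_smul_subset (g : E3 → ℝ) (c : C3) :
    tsupport (fun x => g x • c) ⊆ tsupport g :=
  closure_mono fun x hx hg => hx (by simp [hg])

lemma inner_real_smul_single (r : ℝ) (i : Fin 3) (z : C3) :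
    inner ℂ (r • (EuclideanSpace.single i (1 : ℂ) : C3)) z = r • z i := by
  rw [← Complex.coe_smul, inner_smul_left, EuclideanSpace.inner_single_left]
  simp

/-- The fundamental lemma of the calculus of variations, applied to each component with test fields
`g • e_i`. The general measure `μ` allows its use both in `Ω` and on `∂Ω`. -/
lemma ae_eq_zero_of_forall_integral_inner_eq_zero {μ : Measure E3} {U : Set E3} (hU : IsOpen U)
    {F : E3 → C3} (hF : ∀ i, LocallyIntegrableOn (fun x => F x i) U μ)
    (h : ∀ φ : E3 → C3, IsTestField φ → tsupport φ ⊆ U → ∫ x, inner ℂ (φ x) (F x) ∂μ = 0) :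
    ∀ᵐ x ∂μ, x ∈ U → F x = 0 := by
  have key : ∀ i, ∀ᵐ x ∂μ, x ∈ U → F x i = 0 := by
    intro i
    refine hU.ae_eq_zero_of_integral_contDiff_smul_eq_zero (hF i) fun g hg hc hs => ?_
    have := h _ (IsTestField.of_real_smul hg hc (EuclideanSpace.single i 1))
      ((tsupport_real_smul_subset g _).trans hs)
    simpa only [inner_real_smul_single] using this
  filter_upwards [ae_all_iff.2 key] with x hx hxU
  ext i
  exact hx i hxU

lemma L2_ext_of_forall_integral_inner {Ω : Set E3} (hΩ : IsOpen Ω) {u v : L2 Ω}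
    (h : ∀ φ : E3 → C3, IsTestField φ → tsupport φ ⊆ Ω →
      ∫ x in Ω, inner ℂ (φ x) (u x) = ∫ x in Ω, inner ℂ (φ x) (v x)) : u = v := by
  rw [← sub_eq_zero]
  have hloc : ∀ i, LocallyIntegrableOn (fun x => (u - v : L2 Ω) x i) Ω (volume.restrict Ω) := by
    intro i
    refine LocallyIntegrable.locallyIntegrableOn ?_ _
    refine MemLp.locallyIntegrable (p := 2) ?_ (by norm_num)
    exact (coord i).comp_memLp' (Lp.memLp (u - v))
  have := ae_eq_zero_of_forall_integral_inner_eq_zero (F := (u - v : L2 Ω)) hΩ hloc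
    fun φ hφ hs => by
      rw [sub_eq_add_neg, ← neg_one_smul ℂ v, integral_inner_add (hφ.memLp Ω),
        integral_inner_smul, h φ hφ hs]
      ring
  refine Lp.ext ?_
  filter_upwards [this, ae_restrict_mem hΩ.measurableSet, Lp.coeFn_zero C3 2 (volume.restrict Ω)]
    with x h1 h2 h3
  rw [h1 h2, h3, Pi.zero_apply]

/-! ### The weak curl and the tangential trace are well-defined -/

lemma HasWeakCurl.unique {Ω : Set E3} (hΩ : IsOpen Ω) {u w z : L2 Ω} (h : HasWeakCurl Ω u w)
    (h' : HasWeakCurl Ω u z) : w = z :=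
  L2_ext_of_forall_integral_inner hΩ fun φ hφ hs => by rw [h φ hφ hs, h' φ hφ hs]

lemma HasWeakCurl.curl_eq {Ω : Set E3} (hΩ : IsOpen Ω) {u w : L2 Ω} (h : HasWeakCurl Ω u w) :
    curl Ω u = w := by
  have hex : ∃ w, HasWeakCurl Ω u w := ⟨w, h⟩
  rw [curl, dif_pos hex]
  exact hex.choose_spec.unique hΩ h

lemma HasTangentialTrace.hasWeakCurl {Ω : Set E3} (hΩ : IsOpen Ω) {u : L2 Ω} {g : L2bd Ω}
    (h : HasTangentialTrace Ω u g) : HasWeakCurl Ω u (curl Ω u) := by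
  obtain ⟨-, w, hw, -⟩ := h
  rwa [hw.curl_eq hΩ]

lemma HasTangentialTrace.green {Ω : Set E3} (hΩ : IsOpen Ω) {u : L2 Ω} {g : L2bd Ω}
    (h : HasTangentialTrace Ω u g) {φ : E3 → C3} (hφ : IsTestField φ) :
    Integrable (fun x => inner ℂ (φ x) (cross (normal Ω x) (g x))) (surf Ω) ∧
      (∫ x in Ω, inner ℂ (φ x) (curl Ω u x)) - (∫ x in Ω, inner ℂ (classicalCurl φ x) (u x))
        = ∫ x, inner ℂ (φ x) (cross (normal Ω x) (g x)) ∂(surf Ω) := by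
  obtain ⟨-, w, hw, hi⟩ := h
  rw [hw.curl_eq hΩ]
  exact hi φ hφ

/-- A function on `∂Ω` that is integrable against all test fields is integrable. -/
lemma integrable_apply_of_forall_integrable_inner {Ω : Set E3} (hΩ : IsBoundedLipschitzOpen Ω)
    {F : E3 → C3}
    (h : ∀ φ : E3 → C3, IsTestField φ → Integrable (fun x => inner ℂ (φ x) (F x)) (surf Ω))
    (i : Fin 3) : Integrable (fun x => F x i) (surf Ω) := by
  obtain ⟨R, hR0, hR⟩ := hΩ.isCompact_frontier.isBounded.subset_closedBall_lt 0 (0 : E3)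
  -- A cutoff equal to `1` on the compact boundary: tested against it, `F` gives exactly its `i`-th
  -- component there.
  let b : ContDiffBump (0 : E3) := ⟨R, R + 1, hR0, by linarith⟩
  refine (h _ (IsTestField.of_real_smul (g := b) b.contDiff b.hasCompactSupport
    (EuclideanSpace.single i 1))).congr ?_
  filter_upwards [ae_restrict_mem isClosed_frontier.measurableSet] with x hx
  rw [inner_real_smul_single, b.one_of_mem_closedBall (hR hx), one_smul]

lemma HasTangentialTrace.unique {Ω : Set E3} (hΩ : IsBoundedLipschitzOpen Ω) {u : L2 Ω}
    {g g' : L2bd Ω} (h : HasTangentialTrace Ω u g) (h' : HasTangentialTrace Ω u g') : g = g' := by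
  set F : E3 → C3 := fun x => cross (normal Ω x) (g x) - cross (normal Ω x) (g' x)
  have hF : ∀ φ : E3 → C3, IsTestField φ →
      Integrable (fun x => inner ℂ (φ x) (F x)) (surf Ω) ∧
      ∫ x, inner ℂ (φ x) (F x) ∂(surf Ω) = 0 := by
    intro φ hφ
    obtain ⟨h1, h2⟩ := h.green hΩ.isOpen hφ
    obtain ⟨h1', h2'⟩ := h'.green hΩ.isOpen hφ
    simp only [F, inner_sub_right]
    exact ⟨h1.sub h1', by rw [integral_sub h1 h1', ← h2, ← h2', sub_self]⟩
  -- The test fields in Green's formula are not confined to `Ω`, so the fundamental lemma applies to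
  -- `surf Ω` with the open set `univ`.
  have h0 := ae_eq_zero_of_forall_integral_inner_eq_zero isOpen_univ (fun i =>
    ((integrable_apply_of_forall_integrable_inner hΩ (fun φ hφ => (hF φ hφ).1)
      i).locallyIntegrable.locallyIntegrableOn _)) (fun φ hφ _ => (hF φ hφ).2)
  refine Lp.ext ?_
  filter_upwards [h0, h.1, h'.1, hΩ.ae_norm_normal] with x h1 h2 h3 h4
  rw [← sub_eq_zero]
  refine eq_zero_of_cross_eq_zero h4 (by rw [cross_sub]; exact h1 (mem_univ _)) ?_
  rw [WithLp.ofLp_sub, dotProduct_sub, h2, h3, sub_zero]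

lemma HasTangentialTrace.tangTrace_eq {Ω : Set E3} (hΩ : IsBoundedLipschitzOpen Ω) {u : L2 Ω}
    {g : L2bd Ω} (h : HasTangentialTrace Ω u g) : tangTrace Ω u = g := by
  have hex : ∃ g, HasTangentialTrace Ω u g := ⟨g, h⟩
  rw [tangTrace, dif_pos hex]
  exact hex.choose_spec.unique hΩ h

/-! ### Density of the fields without trace -/

lemma IsTestField.continuous_partialD {φ : E3 → C3} (h : IsTestField φ) (i j : Fin 3) :
    Continuous fun x => partialD φ x i j :=
  (coord j).continuous.comp
    ((h.smooth.continuous_fderiv (by simp)).clm_apply continuous_const)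

lemma IsTestField.hasFDerivAt_apply {φ : E3 → C3} (h : IsTestField φ) (j : Fin 3) (x : E3) :
    HasFDerivAt (fun y => φ y j)
      (((coord j).restrictScalars ℝ).comp
        (fderiv ℝ φ x)) x :=
  ((coord j).restrictScalars
    ℝ).hasFDerivAt.comp x ((h.smooth.differentiable (by simp)) x).hasFDerivAt

lemma IsTestField.hasFDerivAt_conj_apply {φ : E3 → C3} (h : IsTestField φ) (j : Fin 3) (x : E3) :
    HasFDerivAt (fun y => starRingEnd ℂ (φ y j))
      ((Complex.conjCLE : ℂ →L[ℝ] ℂ).comp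
        (((coord j).restrictScalars ℝ).comp
          (fderiv ℝ φ x))) x :=
  (Complex.conjCLE : ℂ →L[ℝ] ℂ).hasFDerivAt.comp x (h.hasFDerivAt_apply j x)

lemma IsTestField.hasCompactSupport_apply {φ : E3 → C3} (h : IsTestField φ) (j : Fin 3) :
    HasCompactSupport fun x => φ x j :=
  h.compact.comp_left (g := fun z : C3 => z j) rfl

lemma IsTestField.fderiv_eq_zero {φ : E3 → C3} {x : E3} (hx : x ∉ tsupport φ) :
    fderiv ℝ φ x = 0 := by
  by_contra hne
  exact hx (support_fderiv_subset ℝ hne)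

lemma IsTestField.hasCompactSupport_partialD {φ : E3 → C3} (h : IsTestField φ) (i j : Fin 3) :
    HasCompactSupport fun x => partialD φ x i j :=
  (h.compact.fderiv (𝕜 := ℝ)).comp_left
    (g := fun A : E3 →L[ℝ] C3 => A (EuclideanSpace.single i (1 : ℝ)) j) rfl

lemma IsTestField.integrable_conj_mul_partialD {φ ψ : E3 → C3} (hφ : IsTestField φ)
    (hψ : IsTestField ψ) (i j l : Fin 3) :
    Integrable (fun x => starRingEnd ℂ (φ x j) * partialD ψ x i l) := by
  refine Continuous.integrable_of_hasCompactSupport ?_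
    (hψ.hasCompactSupport_partialD i l).mul_left
  exact (Complex.continuous_conj.comp ((coord j).continuous.comp hφ.smooth.continuous)).mul
      (hψ.continuous_partialD i l)

lemma IsTestField.integrable_conj_partialD_mul {φ ψ : E3 → C3} (hφ : IsTestField φ)
    (hψ : IsTestField ψ) (i j l : Fin 3) :
    Integrable (fun x => starRingEnd ℂ (partialD φ x i j) * ψ x l) := by
  refine Continuous.integrable_of_hasCompactSupport ?_ (hψ.hasCompactSupport_apply l).mul_left
  exact (Complex.continuous_conj.comp (hφ.continuous_partialD i j)).mul
    ((coord l).continuous.comp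
      hψ.smooth.continuous)

lemma IsTestField.integral_conj_mul_partialD {φ ψ : E3 → C3} (hφ : IsTestField φ)
    (hψ : IsTestField ψ) (i j l : Fin 3) :
    ∫ x, starRingEnd ℂ (φ x j) * partialD ψ x i l =
      -∫ x, starRingEnd ℂ (partialD φ x i j) * ψ x l := by
  have e1 : ∀ x, fderiv ℝ (fun y => ψ y l) x (EuclideanSpace.single i (1 : ℝ)) =
      partialD ψ x i l := fun x => by rw [(hψ.hasFDerivAt_apply l x).fderiv]; rfl
  have e2 : ∀ x, fderiv ℝ (fun y => starRingEnd ℂ (φ y j)) x (EuclideanSpace.single i (1 : ℝ)) =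
      starRingEnd ℂ (partialD φ x i j) := fun x => by
    rw [(hφ.hasFDerivAt_conj_apply j x).fderiv]; rfl
  have hint : Integrable (fun x => starRingEnd ℂ (φ x j) * ψ x l) := by
    refine Continuous.integrable_of_hasCompactSupport ?_ (hψ.hasCompactSupport_apply l).mul_left
    exact (Complex.continuous_conj.comp ((coord j).continuous.comp hφ.smooth.continuous)).mul
      ((coord l).continuous.comp
        hψ.smooth.continuous)
  have := integral_mul_fderiv_eq_neg_fderiv_mul_of_integrable (μ := (volume : Measure E3))
    (f := fun x => starRingEnd ℂ (φ x j)) (g := fun x => ψ x l)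
    (v := EuclideanSpace.single i (1 : ℝ))
    (by simpa only [e2] using hφ.integrable_conj_partialD_mul hψ i j l)
    (by simpa only [e1] using hφ.integrable_conj_mul_partialD hψ i j l) hint
    (fun x _ => (hφ.hasFDerivAt_conj_apply j x).differentiableAt)
    (fun x _ => (hψ.hasFDerivAt_apply l x).differentiableAt)
  simpa only [e1, e2] using this

lemma integral_sub_add_sub_add_sub {f₁ f₂ f₃ f₄ f₅ f₆ : E3 → ℂ} (h₁ : Integrable f₁)
    (h₂ : Integrable f₂) (h₃ : Integrable f₃) (h₄ : Integrable f₄) (h₅ : Integrable f₅)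
    (h₆ : Integrable f₆) :
    ∫ x, (f₁ x - f₂ x) + (f₃ x - f₄ x) + (f₅ x - f₆ x) =
      ((∫ x, f₁ x) - ∫ x, f₂ x) + ((∫ x, f₃ x) - ∫ x, f₄ x) + ((∫ x, f₅ x) - ∫ x, f₆ x) := by
  have h₁₂ : Integrable fun x => f₁ x - f₂ x := h₁.sub h₂
  have h₃₄ : Integrable fun x => f₃ x - f₄ x := h₃.sub h₄
  have h₅₆ : Integrable fun x => f₅ x - f₆ x := h₅.sub h₆
  have h₁₄ : Integrable fun x => (f₁ x - f₂ x) + (f₃ x - f₄ x) := h₁₂.add h₃₄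
  rw [integral_add h₁₄ h₅₆, integral_add h₁₂ h₃₄, integral_sub h₁ h₂, integral_sub h₃ h₄,
    integral_sub h₅ h₆]

lemma IsTestField.integral_inner_classicalCurl {φ ψ : E3 → C3} (hφ : IsTestField φ)
    (hψ : IsTestField ψ) :
    ∫ x, inner ℂ (φ x) (classicalCurl ψ x) = ∫ x, inner ℂ (classicalCurl φ x) (ψ x) := by
  have e1 : ∀ x, inner ℂ (φ x) (classicalCurl ψ x) =
      (starRingEnd ℂ (φ x 0) * partialD ψ x 1 2 - starRingEnd ℂ (φ x 0) * partialD ψ x 2 1)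
      + (starRingEnd ℂ (φ x 1) * partialD ψ x 2 0 - starRingEnd ℂ (φ x 1) * partialD ψ x 0 2)
      + (starRingEnd ℂ (φ x 2) * partialD ψ x 0 1 - starRingEnd ℂ (φ x 2) * partialD ψ x 1 0) := by
    intro x
    rw [PiLp.inner_apply, Fin.sum_univ_three]
    simp [classicalCurl]
    ring
  have e2 : ∀ x, inner ℂ (classicalCurl φ x) (ψ x) =
      (starRingEnd ℂ (partialD φ x 1 2) * ψ x 0 - starRingEnd ℂ (partialD φ x 2 1) * ψ x 0)
      + (starRingEnd ℂ (partialD φ x 2 0) * ψ x 1 - starRingEnd ℂ (partialD φ x 0 2) * ψ x 1)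
      + (starRingEnd ℂ (partialD φ x 0 1) * ψ x 2
        - starRingEnd ℂ (partialD φ x 1 0) * ψ x 2) := by
    intro x
    rw [PiLp.inner_apply, Fin.sum_univ_three]
    simp [classicalCurl]
    ring
  have a := hφ.integrable_conj_mul_partialD hψ
  have b := hφ.integrable_conj_partialD_mul hψ
  simp only [e1, e2]
  rw [integral_sub_add_sub_add_sub (a _ _ _) (a _ _ _) (a _ _ _) (a _ _ _) (a _ _ _) (a _ _ _),
    integral_sub_add_sub_add_sub (b _ _ _) (b _ _ _) (b _ _ _) (b _ _ _) (b _ _ _) (b _ _ _)]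
  simp only [hφ.integral_conj_mul_partialD hψ]
  ring

/-- Since `ψ` is supported in `Ω`, both integrals extend to all of space, where the curl is
symmetric by parts without boundary terms, whatever the support of `φ`. -/
lemma IsTestField.hasTangentialTrace_zero {Ω : Set E3} {ψ : E3 → C3} (hψ : IsTestField ψ)
    (hs : tsupport ψ ⊆ Ω) : HasTangentialTrace Ω ((hψ.memLp Ω).toLp ψ) 0 := by
  have hparts : ∀ φ : E3 → C3, IsTestField φ →
      ∫ x in Ω, inner ℂ (φ x) ((hψ.memLp_curl Ω).toLp (classicalCurl ψ) x) =
        ∫ x in Ω, inner ℂ (classicalCurl φ x) ((hψ.memLp Ω).toLp ψ x) := by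
    intro φ hφ
    have e1 : ∫ x in Ω, inner ℂ (φ x) ((hψ.memLp_curl Ω).toLp (classicalCurl ψ) x) =
        ∫ x in Ω, inner ℂ (φ x) (classicalCurl ψ x) :=
      integral_congr_ae ((hψ.memLp_curl Ω).coeFn_toLp.mono fun x hx => by simp only [hx])
    have e2 : ∫ x in Ω, inner ℂ (classicalCurl φ x) ((hψ.memLp Ω).toLp ψ x) =
        ∫ x in Ω, inner ℂ (classicalCurl φ x) (ψ x) :=
      integral_congr_ae ((hψ.memLp Ω).coeFn_toLp.mono fun x hx => by simp only [hx])
    rw [e1, e2, setIntegral_eq_integral_of_forall_compl_eq_zero fun x hx => ?_,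
      setIntegral_eq_integral_of_forall_compl_eq_zero fun x hx => ?_]
    · exact hφ.integral_inner_classicalCurl hψ
    · rw [image_eq_zero_of_notMem_tsupport (fun h => hx (hs h)), inner_zero_right]
    · have h0 : classicalCurl ψ x = 0 := by
        have hd := IsTestField.fderiv_eq_zero (φ := ψ) fun h => hx (hs h)
        ext i
        fin_cases i <;> simp [classicalCurl, partialD, hd]
      rw [h0, inner_zero_right]
  have e : ∀ φ : E3 → C3, (fun x => inner ℂ (φ x) (cross (normal Ω x) ((0 : L2bd Ω) x)))
        =ᵐ[surf Ω] (fun _ => (0 : ℂ)) := fun φ => by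
    filter_upwards [Lp.coeFn_zero C3 2 (surf Ω)] with x hx
    rw [hx]
    simp [cross]
  refine ⟨(HasTangentialTrace.zero Ω).1, _, fun φ hφ _ => hparts φ hφ, fun φ hφ => ⟨?_, ?_⟩⟩
  · exact (integrable_zero _ _ _).congr (e φ).symm
  · rw [hparts φ hφ, sub_self, integral_congr_ae (e φ), integral_zero]

/-- A vector orthogonal to `H` is orthogonal to all test fields supported in `Ω`, hence zero. -/
lemma dense_of_hasTangentialTrace_zero {Ω : Set E3} (hΩ : IsOpen Ω) {H : Submodule ℂ (L2 Ω)}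
    (hH : ∀ v, HasTangentialTrace Ω v 0 → v ∈ H) : Dense (H : Set (L2 Ω)) := by
  rw [Submodule.dense_iff_topologicalClosure_eq_top, Submodule.topologicalClosure_eq_top_iff,
    Submodule.eq_bot_iff]
  intro u hu
  refine L2_ext_of_forall_integral_inner hΩ fun φ hφ hs => ?_
  have h0 : inner ℂ ((hφ.memLp Ω).toLp φ) u = 0 :=
    hu _ (hH _ (hφ.hasTangentialTrace_zero hs))
  rw [L2.inner_def] at h0
  have hz : ∫ x in Ω, inner ℂ (φ x) ((0 : L2 Ω) x) = 0 := by
    simpa using integral_inner_smul (Ω := Ω) φ 0 0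
  rw [hz, ← h0]
  exact integral_congr_ae ((hφ.memLp Ω).coeFn_toLp.mono fun x hx => by simp only [hx])

/-! ### Closedness of the trace operator -/

lemma continuous_integral_inner {Ω : Set E3} {φ : E3 → C3} (h : MemLp φ 2 (volume.restrict Ω)) :
    Continuous fun u : L2 Ω => ∫ x in Ω, inner ℂ (φ x) (u x) := by
  have : (fun u : L2 Ω => ∫ x in Ω, inner ℂ (φ x) (u x)) = fun u => inner ℂ (h.toLp φ) u := by
    ext u
    rw [L2.inner_def]
    exact integral_congr_ae (h.coeFn_toLp.mono fun x hx => by simp only [hx])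
  rw [this]
  exact continuous_const.inner continuous_id

lemma HasWeakCurl.of_tendsto {Ω : Set E3} {u w : ℕ → L2 Ω} {u' w' : L2 Ω}
    (hu : Tendsto u atTop (𝓝 u')) (hw : Tendsto w atTop (𝓝 w'))
    (h : ∀ n, HasWeakCurl Ω (u n) (w n)) : HasWeakCurl Ω u' w' := fun φ hφ hs =>
  tendsto_nhds_unique (((continuous_integral_inner (hφ.memLp Ω)).tendsto _).comp hw)
    ((((continuous_integral_inner (hφ.memLp_curl Ω)).tendsto _).comp hu).congr fun n =>
      (h n φ hφ hs).symm)

lemma exists_subseq_tendsto_ae {Ω : Set E3} {g : ℕ → L2bd Ω} {g' : L2bd Ω}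
    (hg : Tendsto g atTop (𝓝 g')) : ∃ ns : ℕ → ℕ,
      ∀ᵐ x ∂(surf Ω), Tendsto (fun n => g (ns n) x) atTop (𝓝 (g' x)) := by
  obtain ⟨ns, -, h⟩ := (tendstoInMeasure_of_tendsto_Lp hg).exists_seq_tendsto_ae
  exact ⟨ns, h⟩

/-- The integrand is bounded by `C |g|`, so on the finite measure space `∂Ω`, `L²` convergence of
the traces gives `L¹` convergence of the integrands. -/
lemma tendsto_integral_inner_cross {Ω : Set E3} (hΩ : IsBoundedLipschitzOpen Ω) {φ : E3 → C3}
    (hφ : IsTestField φ) {g : ℕ → L2bd Ω} {g' : L2bd Ω} (hg : Tendsto g atTop (𝓝 g'))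
    (hi : ∀ n, Integrable (fun x => inner ℂ (φ x) (cross (normal Ω x) (g n x))) (surf Ω)) :
    Integrable (fun x => inner ℂ (φ x) (cross (normal Ω x) (g' x))) (surf Ω) ∧
    Tendsto (fun n => ∫ x, inner ℂ (φ x) (cross (normal Ω x) (g n x)) ∂(surf Ω)) atTop
      (𝓝 (∫ x, inner ℂ (φ x) (cross (normal Ω x) (g' x)) ∂(surf Ω))) := by
  have := hΩ.isFiniteMeasure_surf
  obtain ⟨C, hC⟩ := hφ.smooth.continuous.bounded_above_of_compact_support hφ.compact
  have hbound : ∀ x (z : C3), ‖inner ℂ (φ x) (cross (normal Ω x) z)‖ ≤ C * ‖z‖ := by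
    intro x z
    refine (norm_inner_le_norm _ _).trans ?_
    have h1 : ‖cross (normal Ω x) z‖ ≤ ‖z‖ :=
      (norm_cross_le _ _).trans (mul_le_of_le_one_left (norm_nonneg _) (norm_normal_le Ω x))
    exact mul_le_mul (hC x) h1 (norm_nonneg _) ((norm_nonneg _).trans (hC x))
  have hL1 : ∀ v : L2bd Ω, Integrable v (surf Ω) := fun v =>
    (Lp.memLp v).integrable (by norm_num)
  -- Measurability of `normal` is not invoked: the integrand is an a.e. limit, along a subsequence,
  -- of integrands that are integrable by hypothesis.
  have hmeas : AEStronglyMeasurable (fun x => inner ℂ (φ x) (cross (normal Ω x) (g' x)))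
      (surf Ω) := by
    obtain ⟨ns, hns⟩ := exists_subseq_tendsto_ae hg
    refine aestronglyMeasurable_of_tendsto_ae atTop (fun n => (hi (ns n)).1) ?_
    filter_upwards [hns] with x hx
    exact tendsto_const_nhds.inner (((continuous_cross _).tendsto _).comp hx)
  have hint : Integrable (fun x => inner ℂ (φ x) (cross (normal Ω x) (g' x))) (surf Ω) :=
    ((hL1 g').norm.const_mul C).mono' hmeas (ae_of_all _ fun x => hbound x _)
  refine ⟨hint, tendsto_integral_of_L1' _ hint.1 (Eventually.of_forall hi) ?_⟩
  -- The exponent `1 - 1/2` of the total area is the Hölder factor for `L² ⊂ L¹`.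
  have h2 : Tendsto (fun n => ENNReal.ofReal C * (eLpNorm (g n - g' : L2bd Ω) 2 (surf Ω) *
      (surf Ω) univ ^ (1 / (1 : ℝ≥0∞).toReal - 1 / (2 : ℝ≥0∞).toReal))) atTop (𝓝 0) := by
    have h3 : Tendsto (fun n => eLpNorm (g n - g' : L2bd Ω) 2 (surf Ω)) atTop (𝓝 0) := by
      have := (Lp.tendsto_Lp_iff_tendsto_eLpNorm' g g').1 hg
      refine this.congr fun n => eLpNorm_congr_ae (Lp.coeFn_sub _ _).symm
    have h4 := ENNReal.Tendsto.mul_const (b := (surf Ω) univ ^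
      (1 / (1 : ℝ≥0∞).toReal - 1 / (2 : ℝ≥0∞).toReal)) h3
      (Or.inr (ENNReal.rpow_ne_top_of_nonneg (by norm_num) (measure_ne_top _ _)))
    simpa using ENNReal.Tendsto.const_mul (a := ENNReal.ofReal C) h4
      (Or.inr ENNReal.ofReal_ne_top)
  refine tendsto_of_tendsto_of_tendsto_of_le_of_le tendsto_const_nhds h2 (fun _ => zero_le)
    fun n => ?_
  have h5 : ∀ᵐ x ∂(surf Ω), ‖((fun x => inner ℂ (φ x) (cross (normal Ω x) (g n x))) -
      fun x => inner ℂ (φ x) (cross (normal Ω x) (g' x))) x‖ ≤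
      C * ‖(g n - g' : L2bd Ω) x‖ := by
    filter_upwards [Lp.coeFn_sub (g n) g'] with x hx
    rw [hx, Pi.sub_apply, Pi.sub_apply, ← inner_sub_right, ← cross_sub]
    exact hbound x _
  refine (eLpNorm_le_mul_eLpNorm_of_ae_le_mul h5 1).trans ?_
  gcongr
  exact eLpNorm_le_eLpNorm_mul_rpow_measure_univ (by norm_num) (Lp.aestronglyMeasurable _)

/-- Tangency is a closed pointwise condition, preserved along an a.e. convergent subsequence; every
term of Green's formula is continuous in the `L²` data. -/
lemma HasTangentialTrace.of_tendsto {Ω : Set E3} (hΩ : IsBoundedLipschitzOpen Ω) {u : ℕ → L2 Ω}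
    {u' w' : L2 Ω} {g : ℕ → L2bd Ω} {g' : L2bd Ω} (hu : Tendsto u atTop (𝓝 u'))
    (hw : Tendsto (fun n => curl Ω (u n)) atTop (𝓝 w')) (hg : Tendsto g atTop (𝓝 g'))
    (h : ∀ n, HasTangentialTrace Ω (u n) (g n)) : HasTangentialTrace Ω u' g' := by
  refine ⟨?_, w', .of_tendsto hu hw fun n => (h n).hasWeakCurl hΩ.isOpen, fun φ hφ => ?_⟩
  · obtain ⟨ns, hns⟩ := exists_subseq_tendsto_ae hg
    filter_upwards [hns, ae_all_iff.2 fun n => (h n).1] with x hx h0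
    have hc : Continuous fun z : C3 => toC (normal Ω x) ⬝ᵥ z.ofLp := by
      simp only [dotProduct]
      fun_prop
    exact tendsto_nhds_unique ((hc.tendsto _).comp hx)
      (tendsto_const_nhds.congr fun n => (h0 (ns n)).symm)
  · obtain ⟨h1, h2⟩ := tendsto_integral_inner_cross hΩ hφ hg
      fun n => ((h n).green hΩ.isOpen hφ).1
    refine ⟨h1, tendsto_nhds_unique ?_ h2⟩
    refine Tendsto.congr (fun n => ((h n).green hΩ.isOpen hφ).2) ?_
    exact (((continuous_integral_inner (hφ.memLp Ω)).tendsto _).comp hw).sub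
      (((continuous_integral_inner (hφ.memLp_curl Ω)).tendsto _).comp hu)

lemma ae_eq_zero_of_tendsto {Ω S : Set E3} {g : ℕ → L2bd Ω} {g' : L2bd Ω}
    (hg : Tendsto g atTop (𝓝 g')) (h : ∀ n, ∀ᵐ x ∂((surf Ω).restrict S), g n x = 0) :
    ∀ᵐ x ∂((surf Ω).restrict S), g' x = 0 := by
  obtain ⟨ns, hns⟩ := exists_subseq_tendsto_ae hg
  filter_upwards [ae_restrict_of_ae hns, ae_all_iff.2 h] with x hx h0
  exact tendsto_nhds_unique hx (tendsto_const_nhds.congr fun n => (h0 (ns n)).symm)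

end Maxwell

/-! ### Graph-norm Hilbert spaces and abstract Gårding inequalities -/

namespace AbstractWave

lemma nrm_eq_norm {V W : Type*} [NormedAddCommGroup W] [InnerProductSpace ℂ W]
    {ip : V → V → ℂ} {T : V → W} (h : ∀ u v, ip u v = inner ℂ (T v) (T u)) (v : V) :
    nrm ip v = ‖T v‖ := by
  rw [nrm, h, norm_eq_sqrt_re_inner (𝕜 := ℂ)]
  rfl

/-- An inner product that is pulled back from a Hilbert space by an injective linear map with
complete range makes the domain a Hilbert space. -/
lemma IsHilbertInner.of_linearMap {V W : Type*} [AddCommGroup V] [Module ℂ V]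
    [NormedAddCommGroup W] [InnerProductSpace ℂ W] {ip : V → V → ℂ} (T : V →ₗ[ℂ] W)
    (hinj : Function.Injective T) (hT : IsComplete (range T))
    (h : ∀ u v, ip u v = inner ℂ (T v) (T u)) : IsHilbertInner ip := by
  let c : InnerProductSpace.Core ℂ V :=
    { inner := fun u v => inner ℂ (T u) (T v)
      conj_inner_symm := fun x y => inner_conj_symm _ _
      re_inner_nonneg := fun x => inner_self_nonneg
      add_left := fun x y z => by rw [map_add, inner_add_left]
      smul_left := fun x y r => by rw [map_smul, inner_smul_left]
      definite := fun x hx => hinj (by rw [map_zero]; exact inner_self_eq_zero.1 hx) }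
  refine ⟨c, fun u v => (h u v).symm, ?_⟩
  let _ : NormedAddCommGroup V := c.toNormedAddCommGroup
  have hiso : Isometry T := AddMonoidHomClass.isometry_of_norm T fun v =>
    norm_eq_sqrt_re_inner (𝕜 := ℂ) (T v)
  exact (completeSpace_iff_isComplete_range hiso.isUniformInducing).2 hT

section Graph

variable {H₀ Z : Type*} [NormedAddCommGroup H₀] [InnerProductSpace ℂ H₀]
  [NormedAddCommGroup Z] [InnerProductSpace ℂ Z] {H : Submodule ℂ H₀}

/-- The embedding of `H` into a Hilbert space as the graph of `(D, τ)`. -/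
def graphMap (D : H →ₗ[ℂ] H₀) (τ : H →ₗ[ℂ] Z) : H →ₗ[ℂ] WithLp 2 (WithLp 2 (H₀ × H₀) × Z) where
  toFun v := WithLp.toLp 2 (WithLp.toLp 2 (D v, (v : H₀)), τ v)
  map_add' u v := by simp [← WithLp.toLp_add]
  map_smul' c v := by simp [← WithLp.toLp_smul]

lemma graphMap_apply (D : H →ₗ[ℂ] H₀) (τ : H →ₗ[ℂ] Z) (v : H) :
    graphMap D τ v = WithLp.toLp 2 (WithLp.toLp 2 (D v, (v : H₀)), τ v) := rfl

lemma graphMap_injective (D : H →ₗ[ℂ] H₀) (τ : H →ₗ[ℂ] Z) :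
    Function.Injective (graphMap D τ) := fun _ _ h =>
  Subtype.ext (congrArg (fun z => z.fst.snd) h)

lemma inner_graphMap (D : H →ₗ[ℂ] H₀) (τ : H →ₗ[ℂ] Z) (u v : H) :
    inner ℂ (graphMap D τ v) (graphMap D τ u) =
      inner ℂ (D v) (D u) + inner ℂ (v : H₀) (u : H₀) + inner ℂ (τ v) (τ u) := by
  simp [graphMap_apply]

lemma norm_graphMap_sq (D : H →ₗ[ℂ] H₀) (τ : H →ₗ[ℂ] Z) (v : H) :
    ‖graphMap D τ v‖ ^ 2 = ‖D v‖ ^ 2 + ‖(v : H₀)‖ ^ 2 + ‖τ v‖ ^ 2 := by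
  simp [graphMap_apply, WithLp.prod_norm_sq_eq_of_L2]

/-- The range is the graph of `(D, τ)` inside a Hilbert space, so it is complete once it is
sequentially closed. -/
lemma isComplete_range_graphMap [CompleteSpace H₀] [CompleteSpace Z] {D : H →ₗ[ℂ] H₀} {τ : H →ₗ[ℂ] Z}
    (hclosed : ∀ (v : ℕ → H) (x y : H₀) (z : Z), Tendsto (fun n => D (v n)) atTop (𝓝 x) →
      Tendsto (fun n => (v n : H₀)) atTop (𝓝 y) → Tendsto (fun n => τ (v n)) atTop (𝓝 z) →
      ∃ w : H, D w = x ∧ (w : H₀) = y ∧ τ w = z) :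
    IsComplete (range (graphMap D τ)) := by
  refine IsClosed.isComplete (IsSeqClosed.isClosed fun f p hf hp => ?_)
  choose v hv using hf
  have h1 : Tendsto (fun n => (f n).fst) atTop (𝓝 p.fst) :=
    ((WithLp.fstL 2 ℂ (WithLp 2 (H₀ × H₀)) Z).continuous.tendsto p).comp hp
  have h2 : Tendsto (fun n => (f n).snd) atTop (𝓝 p.snd) :=
    ((WithLp.sndL 2 ℂ (WithLp 2 (H₀ × H₀)) Z).continuous.tendsto p).comp hp
  have h3 : Tendsto (fun n => (f n).fst.fst) atTop (𝓝 p.fst.fst) :=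
    ((WithLp.fstL 2 ℂ H₀ H₀).continuous.tendsto p.fst).comp h1
  have h4 : Tendsto (fun n => (f n).fst.snd) atTop (𝓝 p.fst.snd) :=
    ((WithLp.sndL 2 ℂ H₀ H₀).continuous.tendsto p.fst).comp h1
  simp only [← hv] at h2 h3 h4
  obtain ⟨w, hw1, hw2, hw3⟩ := hclosed v _ _ _ h3 h4 h2
  refine ⟨w, ?_⟩
  rw [graphMap_apply, hw1, hw2, hw3]
  rfl

/-- The abstract assumptions for a form `b(u,v) = -i (Θ τ u, τ v)`, apart from the Gårding
inequality. -/
lemma AbstractAssumption.of_graph [CompleteSpace H₀] [CompleteSpace Z] {ip b : H → H → ℂ} (D : H →ₗ[ℂ] H₀) (τ : H →ₗ[ℂ] Z)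
    (Θ : Z →L[ℂ] Z) (μinv ε : Fin 2 → H₀ →L[ℂ] H₀) {CG₁ CG₂ : Fin 2 → ℝ}
    (hdense : Dense (H : Set H₀))
    (hclosed : ∀ (v : ℕ → H) (x y : H₀) (z : Z), Tendsto (fun n => D (v n)) atTop (𝓝 x) →
      Tendsto (fun n => (v n : H₀)) atTop (𝓝 y) → Tendsto (fun n => τ (v n)) atTop (𝓝 z) →
      ∃ w : H, D w = x ∧ (w : H₀) = y ∧ τ w = z)
    (hip : ∀ u v, ip u v =
      inner ℂ (D v) (D u) + inner ℂ (v : H₀) (u : H₀) + inner ℂ (τ v) (τ u))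
    (hb : ∀ u v, b u v = -Complex.I * inner ℂ (τ v) (Θ (τ u)))
    (h₁ : ∀ ℓ, 0 < CG₁ ℓ) (h₂ : ∀ ℓ, 0 < CG₂ ℓ)
    (hG : ∀ (ℓ : Fin 2) (v : H), CG₁ ℓ * (‖D v‖ ^ 2 + ‖(v : H₀)‖ ^ 2 + ‖τ v‖ ^ 2) ≤
      ‖inner ℂ (D v) (μinv ℓ (D v)) + -Complex.I * inner ℂ (τ v) (Θ (τ v))
        - inner ℂ (v : H₀) (ε ℓ v) + ((CG₂ ℓ * ‖(v : H₀)‖ ^ 2 : ℝ) : ℂ)‖) :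
    AbstractAssumption H ip D b (fun ℓ => μinv ℓ) (fun ℓ => ε ℓ) ‖Θ‖ CG₁ CG₂ := by
  have hip' : ∀ u v, ip u v = inner ℂ (graphMap D τ v) (graphMap D τ u) := fun u v => by
    rw [hip, inner_graphMap]
  have hn : ∀ v, nrm ip v = ‖graphMap D τ v‖ := nrm_eq_norm hip'
  have hsq := norm_graphMap_sq D τ
  have hτ : ∀ v, ‖τ v‖ ≤ nrm ip v := fun v => by
    rw [hn]
    exact le_of_sq_le_sq (by rw [hsq]; nlinarith [sq_nonneg ‖D v‖, sq_nonneg ‖(v : H₀)‖])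
      (norm_nonneg _)
  refine
    { hilbert := .of_linearMap _ (graphMap_injective D τ) (isComplete_range_graphMap hclosed) hip'
      norm_le := fun v => ?_
      dense := hdense
      D_linear := D.isLinear
      D_norm_le := fun v => ?_
      b_add_left := fun u u' v => by
        rw [hb, hb, hb, map_add, map_add, inner_add_right, mul_add]
      b_smul_left := fun c u v => by
        rw [hb, hb, map_smul, map_smul, inner_smul_right, mul_left_comm]
      b_add_right := fun u v v' => by
        rw [hb, hb, hb, map_add, inner_add_left, mul_add]
      b_smul_right := fun c u v => by
        rw [hb, hb, map_smul, inner_smul_left, mul_left_comm]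
      b_continuous := fun u v => ?_
      μinv_bounded := fun ℓ => (μinv ℓ).isBoundedLinearMap
      ε_bounded := fun ℓ => (ε ℓ).isBoundedLinearMap
      CG₁_pos := h₁
      CG₂_pos := h₂
      garding := fun ℓ v => ?_ }
  · rw [hn]
    exact le_of_sq_le_sq (by rw [hsq]; nlinarith [sq_nonneg ‖D v‖, sq_nonneg ‖τ v‖])
      (norm_nonneg _)
  · rw [hn]
    exact le_of_sq_le_sq (by rw [hsq]; nlinarith [sq_nonneg ‖(v : H₀)‖, sq_nonneg ‖τ v‖])
      (norm_nonneg _)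
  · rw [hb, norm_mul, norm_neg, Complex.norm_I, one_mul]
    calc ‖inner ℂ (τ v) (Θ (τ u))‖ ≤ ‖τ v‖ * ‖Θ (τ u)‖ := norm_inner_le_norm _ _
      _ ≤ nrm ip v * (‖Θ‖ * nrm ip u) :=
        mul_le_mul (hτ v) ((Θ.le_opNorm _).trans (by gcongr; exact hτ u)) (norm_nonneg _)
          ((norm_nonneg _).trans (hτ v))
      _ = _ := by ring
  · rw [hn, hsq, sesq, hb]
    exact hG ℓ v

end Graph

/-- The Gårding inequality when `b = 0`. -/
lemma garding_of_re_le {X Y : ℂ} {A B c e : ℝ} (hX : c * A ≤ X.re) (hY : ‖Y‖ ≤ e * B) :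
    c * (A + B) ≤ ‖X - Y + (((e + c) * B : ℝ) : ℂ)‖ := by
  refine le_trans ?_ (Complex.re_le_norm _)
  rw [Complex.add_re, Complex.sub_re, Complex.ofReal_re]
  linarith [(Complex.re_le_norm Y).trans hY]

/-- The Gårding inequality when `b` is purely imaginary and the other terms are real. -/
lemma garding_of_im_eq_zero {X Y Z : ℂ} {A B T c c' e : ℝ} (hA : 0 ≤ A) (hB : 0 ≤ B) (hT : 0 ≤ T)
    (hX : c * A ≤ X.re) (hX' : X.im = 0) (hY : ‖Y‖ ≤ e * B) (hY' : Y.im = 0)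
    (hZ : c' * T ≤ Z.re) (hZ' : Z.im = 0) :
    min c c' / 2 * (A + B + T) ≤
      ‖X + -Complex.I * Z - Y + (((e + c) * B : ℝ) : ℂ)‖ := by
  set w := X + -Complex.I * Z - Y + (((e + c) * B : ℝ) : ℂ)
  have hre : w.re = X.re - Y.re + (e + c) * B := by simp [w, hZ']
  have him : w.im = -Z.re := by simp [w, hX', hY']
  -- Adding `Re w ≤ ‖w‖` and `-Im w ≤ ‖w‖` bounds `2 ‖w‖` from below, whence the factor `1/2` in the
  -- constant.
  have h1 := Complex.re_le_norm w
  have h2 := (neg_le_abs w.im).trans (Complex.abs_im_le_norm w)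
  have h3 := (Complex.re_le_norm Y).trans hY
  have h4 : min c c' * (A + B) ≤ c * (A + B) :=
    mul_le_mul_of_nonneg_right (min_le_left _ _) (by positivity)
  have h5 : min c c' * T ≤ c' * T := mul_le_mul_of_nonneg_right (min_le_right _ _) hT
  linarith

end AbstractWave

namespace Maxwell

/-! ### Multiplication operators -/

lemma norm_le_sum_norm (z : C3) : ‖z‖ ≤ ∑ i, ‖z i‖ := by
  refine le_of_sq_le_sq ?_ (Finset.sum_nonneg fun i _ => norm_nonneg _)
  rw [EuclideanSpace.norm_sq_eq, Fin.sum_univ_three, Fin.sum_univ_three]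
  have := mul_nonneg (norm_nonneg (z 0)) (norm_nonneg (z 1))
  have := mul_nonneg (norm_nonneg (z 0)) (norm_nonneg (z 2))
  have := mul_nonneg (norm_nonneg (z 1)) (norm_nonneg (z 2))
  nlinarith

lemma norm_mulVec_le (M : Matrix (Fin 3) (Fin 3) ℂ) (z : C3) :
    ‖(WithLp.toLp 2 (M *ᵥ z.ofLp) : C3)‖ ≤ (∑ i, ∑ j, ‖M i j‖) * ‖z‖ := by
  refine (norm_le_sum_norm _).trans ?_
  rw [Finset.sum_mul]
  refine Finset.sum_le_sum fun i _ => ?_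
  rw [Finset.sum_mul]
  change ‖∑ j, M i j * z j‖ ≤ _
  refine (norm_sum_le _ _).trans (Finset.sum_le_sum fun j _ => ?_)
  rw [norm_mul]
  exact mul_le_mul_of_nonneg_left (PiLp.norm_apply_le z j) (norm_nonneg _)

section MulOp

variable {μ : Measure E3} {M : E3 → Matrix (Fin 3) (Fin 3) ℂ}

lemma exists_ae_norm_mulVec_le (hM : ∀ i j, MemLp (fun x => M x i j) ∞ μ) :
    ∃ C : ℝ, ∀ᵐ x ∂μ, ∀ z : C3, ‖(WithLp.toLp 2 (M x *ᵥ z.ofLp) : C3)‖ ≤ C * ‖z‖ := by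
  refine ⟨∑ i, ∑ j, (eLpNorm (fun x => M x i j) ∞ μ).toReal, ?_⟩
  have h : ∀ i j, ∀ᵐ x ∂μ, ‖M x i j‖ ≤ (eLpNorm (fun x => M x i j) ∞ μ).toReal := by
    intro i j
    filter_upwards [ae_le_eLpNormEssSup (f := fun x => M x i j) (μ := μ)] with x hx
    rw [← eLpNorm_exponent_top] at hx
    rw [← toReal_enorm]
    exact ENNReal.toReal_mono (hM i j).2.ne hx
  filter_upwards [ae_all_iff.2 fun i => ae_all_iff.2 fun j => h i j] with x hx z
  refine (norm_mulVec_le _ _).trans (mul_le_mul_of_nonneg_right ?_ (norm_nonneg _))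
  exact Finset.sum_le_sum fun i _ => Finset.sum_le_sum fun j _ => hx i j

lemma memLp_mulVec (hM : ∀ i j, MemLp (fun x => M x i j) ∞ μ) (u : Lp C3 2 μ) :
    MemLp (fun x => (WithLp.toLp 2 (M x *ᵥ (u x).ofLp) : C3)) 2 μ := by
  obtain ⟨C, hC⟩ := exists_ae_norm_mulVec_le hM
  refine (Lp.memLp u).of_le_mul ?_ (hC.mono fun x hx => hx (u x))
  refine (PiLp.continuous_toLp 2 _).comp_aestronglyMeasurable
    (aemeasurable_pi_iff.2 fun i => ?_).aestronglyMeasurable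
  change AEMeasurable (fun x => ∑ j, M x i j * u x j) μ
  refine Finset.aemeasurable_fun_sum _ fun j _ =>
    (hM i j).1.aemeasurable.mul (AEStronglyMeasurable.aemeasurable ?_)
  exact (coord j).continuous.comp_aestronglyMeasurable (Lp.aestronglyMeasurable u)

/-- Multiplication by a bounded matrix function is a bounded operator on `L²`. -/
lemma exists_mulVec_clm (hM : ∀ i j, MemLp (fun x => M x i j) ∞ μ) :
    ∃ A : Lp C3 2 μ →L[ℂ] Lp C3 2 μ, ∀ u, A u = (memLp_mulVec hM u).toLp _ := by
  obtain ⟨C, hC⟩ := exists_ae_norm_mulVec_le hM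
  refine ⟨LinearMap.mkContinuous
    { toFun := fun u => (memLp_mulVec hM u).toLp _
      map_add' := fun u v => ?_
      map_smul' := fun c u => ?_ } C fun u => ?_, fun u => rfl⟩
  · rw [← MemLp.toLp_add]
    refine MemLp.toLp_congr _ _ ?_
    filter_upwards [Lp.coeFn_add u v] with x hx
    rw [hx, Pi.add_apply, Pi.add_apply, WithLp.ofLp_add, Matrix.mulVec_add, WithLp.toLp_add]
  · rw [RingHom.id_apply, ← MemLp.toLp_const_smul]
    refine MemLp.toLp_congr _ _ ?_
    filter_upwards [Lp.coeFn_smul c u] with x hx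
    rw [hx, Pi.smul_apply, Pi.smul_apply, WithLp.ofLp_smul, Matrix.mulVec_smul, WithLp.toLp_smul]
  · refine Lp.norm_le_mul_norm_of_ae_le_mul ?_
    filter_upwards [hC, (memLp_mulVec hM u).coeFn_toLp] with x hx hx'
    change ‖((memLp_mulVec hM u).toLp _ : Lp C3 2 μ) x‖ ≤ _
    rw [hx']
    exact hx (u x)

end MulOp

lemma exists_clm_eq_mulOp {Ω : Set E3} {M : E3 → Matrix (Fin 3) (Fin 3) ℂ}
    (hM : ∀ i j, MemLp (fun x => M x i j) ∞ (volume.restrict Ω)) :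
    ∃ A : L2 Ω →L[ℂ] L2 Ω, ⇑A = mulOp Ω M ∧
      ∀ u, A u =ᵐ[volume.restrict Ω] fun x => (WithLp.toLp 2 (M x *ᵥ (u x).ofLp) : C3) := by
  obtain ⟨A, hA⟩ := exists_mulVec_clm hM
  refine ⟨A, funext fun u => ?_, fun u => ?_⟩
  · rw [hA, mulOp, dif_pos (memLp_mulVec hM u)]
  · rw [hA]
    exact (memLp_mulVec hM u).coeFn_toLp

lemma exists_clm_real_smul {μ : Measure E3} {θ : E3 → ℝ} (hθ : MemLp θ ∞ μ) :
    ∃ A : Lp C3 2 μ →L[ℂ] Lp C3 2 μ, ∀ u, A u =ᵐ[μ] fun x => (θ x : ℂ) • u x := by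
  -- Multiplication by `θ` is multiplication by the matrix `θ · 1`.
  have hM : ∀ i j, MemLp (fun x => ((θ x : ℂ) • (1 : Matrix (Fin 3) (Fin 3) ℂ)) i j) ∞ μ := by
    intro i j
    have h := (hθ.ofReal (K := ℂ)).mul_const ((1 : Matrix (Fin 3) (Fin 3) ℂ) i j)
    exact h
  obtain ⟨A, hA⟩ := exists_mulVec_clm hM
  refine ⟨A, fun u => ?_⟩
  rw [hA]
  filter_upwards [(memLp_mulVec hM u).coeFn_toLp] with x hx
  rw [hx, Matrix.smul_mulVec, Matrix.one_mulVec]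
  rfl

/-! ### Inner products in `L²` with pointwise bounds -/

lemma le_re_inner_of_ae {μ : Measure E3} {f g : Lp C3 2 μ} {c : ℝ}
    (h : ∀ᵐ x ∂μ, c * ‖f x‖ ^ 2 ≤ (inner ℂ (f x) (g x)).re) :
    c * ‖f‖ ^ 2 ≤ (inner ℂ f g).re := by
  have e1 : ‖f‖ ^ 2 = ∫ x, ‖f x‖ ^ 2 ∂μ := by
    rw [← inner_self_eq_norm_sq (𝕜 := ℂ) f, L2.inner_def,
      ← integral_re (L2.integrable_inner (𝕜 := ℂ) f f)]
    exact integral_congr_ae (ae_of_all _ fun x => inner_self_eq_norm_sq (𝕜 := ℂ) (f x))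
  have e2 : (inner ℂ f g).re = ∫ x, (inner ℂ (f x) (g x)).re ∂μ := by
    rw [L2.inner_def]
    exact (integral_re (L2.integrable_inner (𝕜 := ℂ) f g)).symm
  rw [e1, e2, ← integral_const_mul]
  refine integral_mono_ae ?_ (L2.integrable_inner (𝕜 := ℂ) f g).re h
  exact ((memLp_two_iff_integrable_sq_norm (Lp.aestronglyMeasurable f)).1 (Lp.memLp f)).const_mul c

lemma im_inner_eq_zero_of_ae {μ : Measure E3} {f g : Lp C3 2 μ}
    (h : ∀ᵐ x ∂μ, (inner ℂ (f x) (g x)).im = 0) : (inner ℂ f g).im = 0 := by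
  have e : (inner ℂ f g).im = ∫ x, (inner ℂ (f x) (g x)).im ∂μ := by
    rw [L2.inner_def]
    exact (integral_im (L2.integrable_inner (𝕜 := ℂ) f g)).symm
  rw [e]
  exact integral_eq_zero_of_ae h

lemma inner_ofReal_smul_smul {E : Type*} [NormedAddCommGroup E] [InnerProductSpace ℂ E] (r : ℝ)
    (f g : E) : inner ℂ ((r : ℂ) • f) ((r : ℂ) • g) = ((r * r : ℝ) : ℂ) * inner ℂ f g := by
  rw [inner_smul_left, inner_smul_right, Complex.conj_ofReal, ← mul_assoc, Complex.ofReal_mul]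

lemma inner_toLp_mulVec (M : Matrix (Fin 3) (Fin 3) ℂ) (z : C3) :
    inner ℂ z (WithLp.toLp 2 (M *ᵥ z.ofLp) : C3) = star z.ofLp ⬝ᵥ (M *ᵥ z.ofLp) := by
  rw [EuclideanSpace.inner_eq_star_dotProduct, dotProduct_comm]

/-- The pointwise lower bound, integrated; `v` stands for `M u`. The constant is chosen before `u`,
so it can serve for every `k`. -/
lemma IsCoefficient.le_re_inner {Ω : Set E3} {M : E3 → Matrix (Fin 3) (Fin 3) ℂ}
    (hM : IsCoefficient Ω M) : ∃ c : ℝ, 0 < c ∧ ∀ u v : L2 Ω,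
      (v =ᵐ[volume.restrict Ω] fun x => (WithLp.toLp 2 (M x *ᵥ (u x).ofLp) : C3)) →
      c * ‖u‖ ^ 2 ≤ (inner ℂ u v).re := by
  obtain ⟨c, hc, h⟩ := hM.pos
  refine ⟨c, hc, fun u v huv => le_re_inner_of_ae ?_⟩
  filter_upwards [h, huv] with x hx hv
  rw [hv, inner_toLp_mulVec, EuclideanSpace.norm_sq_eq]
  exact hx _

lemma IsCoefficient.im_inner {Ω : Set E3} {M : E3 → Matrix (Fin 3) (Fin 3) ℂ}
    (hM : IsCoefficient Ω M) (hr : IsRealValued Ω M) {u v : L2 Ω}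
    (huv : v =ᵐ[volume.restrict Ω] fun x => (WithLp.toLp 2 (M x *ᵥ (u x).ofLp) : C3)) :
    (inner ℂ u v).im = 0 := by
  refine im_inner_eq_zero_of_ae ?_
  filter_upwards [hM.symm, hr, huv] with x hs hx hv
  -- Symmetry here is `Mᵀ = M`; only together with real entries does it make the quadratic form
  -- real.
  have hH : (M x).IsHermitian := by
    ext i j
    rw [Matrix.conjTranspose_apply, hs.apply]
    exact Complex.conj_eq_iff_im.2 (hx i j)
  rw [hv, inner_toLp_mulVec]
  exact hH.im_star_dotProduct_mulVec_self _

/-! ### The curl and the trace as linear maps -/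

section LinearMaps

variable {Ω : Set E3} {H : Submodule ℂ (L2 Ω)}

/-- `D = k⁻¹ curl` as a linear map. -/
def DcurlLM (hΩ : IsOpen Ω) (k : ℝ) (hH : ∀ v ∈ H, ∃ g, HasTangentialTrace Ω v g) :
    H →ₗ[ℂ] L2 Ω where
  toFun := Dcurl Ω k H
  map_add' u v := by
    obtain ⟨g, hg⟩ := hH u u.2
    obtain ⟨g', hg'⟩ := hH v v.2
    rw [Dcurl, Submodule.coe_add,
      ((hg.hasWeakCurl hΩ).add (hg'.hasWeakCurl hΩ)).curl_eq hΩ, smul_add]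
    rfl
  map_smul' c u := by
    obtain ⟨g, hg⟩ := hH u u.2
    rw [Dcurl, Submodule.coe_smul, ((hg.hasWeakCurl hΩ).smul c).curl_eq hΩ, smul_comm]
    rfl

/-- A multiple of the tangential trace as a linear map. -/
def traceLM (hΩ : IsBoundedLipschitzOpen Ω) (r : ℝ)
    (hH : ∀ v ∈ H, ∃ g, HasTangentialTrace Ω v g) : H →ₗ[ℂ] L2bd Ω where
  toFun v := (r : ℂ) • tangTrace Ω (v : L2 Ω)
  map_add' u v := by
    obtain ⟨g, hg⟩ := hH u u.2
    obtain ⟨g', hg'⟩ := hH v v.2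
    rw [Submodule.coe_add, (hg.add hg').tangTrace_eq hΩ, hg.tangTrace_eq hΩ,
      hg'.tangTrace_eq hΩ, smul_add]
  map_smul' c u := by
    obtain ⟨g, hg⟩ := hH u u.2
    rw [Submodule.coe_smul, (hg.smul c).tangTrace_eq hΩ, hg.tangTrace_eq hΩ, smul_comm]
    rfl

lemma tendsto_curl_of_tendsto_Dcurl {k : ℝ} (hk : 0 < k) {v : ℕ → H} {x : L2 Ω}
    (h : Tendsto (fun n => Dcurl Ω k H (v n)) atTop (𝓝 x)) :
    Tendsto (fun n => curl Ω (v n : L2 Ω)) atTop (𝓝 ((k : ℂ) • x)) := by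
  refine (h.const_smul (k : ℂ)).congr fun n => ?_
  rw [Dcurl, smul_smul, ← Complex.ofReal_mul, mul_inv_cancel₀ hk.ne', Complex.ofReal_one, one_smul]

lemma Dcurl_eq_of_curl_eq {k : ℝ} (hk : 0 < k) {v : H} {x : L2 Ω}
    (h : curl Ω (v : L2 Ω) = (k : ℂ) • x) : Dcurl Ω k H v = x := by
  rw [Dcurl, h, smul_smul, ← Complex.ofReal_mul, inv_mul_cancel₀ hk.ne', Complex.ofReal_one,
    one_smul]

end LinearMaps

lemma Himp_exists_trace {Ω Γ : Set E3} : ∀ v ∈ Himp Ω Γ, ∃ g, HasTangentialTrace Ω v g :=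
  fun _ ⟨g, hg, _⟩ => ⟨g, hg⟩

lemma HPEC_exists_trace {Ω : Set E3} : ∀ v ∈ HPEC Ω, ∃ g, HasTangentialTrace Ω v g :=
  fun _ hv => ⟨0, hv⟩

/-- The trace of an element of the impedance space vanishes off `Γ`. -/
lemma tangTrace_ae_eq_zero {Ω Γ : Set E3} (hΩ : IsBoundedLipschitzOpen Ω) (hΓ : MeasurableSet Γ)
    (v : Himp Ω Γ) : ∀ᵐ x ∂(surf Ω), x ∉ Γ → tangTrace Ω (v : L2 Ω) x = 0 := by
  obtain ⟨g, hg, h0⟩ := v.2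
  rw [hg.tangTrace_eq hΩ]
  exact (ae_restrict_iff' hΓ.compl).1 h0

/-- Traces vanish off `Γ`, so the whole of `L²(∂Ω)` can serve as the target of `τ`. -/
lemma setIntegral_inner_tangTrace {Ω Γ : Set E3} (hΩ : IsBoundedLipschitzOpen Ω)
    (hΓ : MeasurableSet Γ) (u v : Himp Ω Γ) :
    ∫ x in Γ, inner ℂ (tangTrace Ω (v : L2 Ω) x) (tangTrace Ω (u : L2 Ω) x) ∂(surf Ω) =
      inner ℂ (tangTrace Ω (v : L2 Ω)) (tangTrace Ω (u : L2 Ω)) := by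
  rw [L2.inner_def]
  refine setIntegral_eq_integral_of_ae_compl_eq_zero ?_
  filter_upwards [tangTrace_ae_eq_zero hΩ hΓ u] with x hx hxΓ
  rw [hx hxΓ, inner_zero_right]

lemma ipImp_eq {Ω Γ : Set E3} (hΩ : IsBoundedLipschitzOpen Ω) (hΓ : MeasurableSet Γ) {k r : ℝ}
    (hr : r * r = k⁻¹) (u v : Himp Ω Γ) :
    ipImp Ω Γ k u v = inner ℂ (Dcurl Ω k _ v) (Dcurl Ω k _ u) + inner ℂ (v : L2 Ω) (u : L2 Ω)
      + inner ℂ ((r : ℂ) • tangTrace Ω (v : L2 Ω)) ((r : ℂ) • tangTrace Ω (u : L2 Ω)) := by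
  rw [inner_ofReal_smul_smul r (tangTrace Ω (v : L2 Ω)), hr, Dcurl, Dcurl,
    inner_ofReal_smul_smul k⁻¹ (curl Ω (v : L2 Ω)), ← setIntegral_inner_tangTrace hΩ hΓ, ← sq]
  rfl

/-- Extending `θ` by zero off `Γ` turns it into a bounded operator on `L²(∂Ω)`, and `k⁻¹ = r * r` is
shared between the two traces. -/
lemma bImp_eq {Ω Γ : Set E3} (hΓ : MeasurableSet Γ) {k r : ℝ}
    (hr : r * r = k⁻¹) {θ : E3 → ℝ} {Θ : L2bd Ω →L[ℂ] L2bd Ω}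
    (hΘ : ∀ g, Θ g =ᵐ[surf Ω] fun x => ((Γ.indicator θ x : ℝ) : ℂ) • g x) (u v : Himp Ω Γ) :
    bImp Ω Γ k θ u v = -Complex.I *
      inner ℂ ((r : ℂ) • tangTrace Ω (v : L2 Ω)) (Θ ((r : ℂ) • tangTrace Ω (u : L2 Ω))) := by
  rw [map_smul, inner_ofReal_smul_smul r (tangTrace Ω (v : L2 Ω)), hr, bImp, mul_assoc,
    L2.inner_def, ← integral_indicator hΓ]
  congr 2
  refine integral_congr_ae ?_
  filter_upwards [hΘ (tangTrace Ω (u : L2 Ω))] with x hx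
  rw [hx, inner_smul_right]
  by_cases hxΓ : x ∈ Γ <;> simp [hxΓ]

/-! ### The two problems -/

theorem abstractAssumption_PEC {Ω : Set E3} (hΩ : IsBoundedLipschitzOpen Ω)
    {μinv ε : Fin 2 → E3 → Matrix (Fin 3) (Fin 3) ℂ}
    (hμ : ∀ ℓ, IsCoefficient Ω (μinv ℓ)) (hε : ∀ ℓ, IsCoefficient Ω (ε ℓ)) :
    ∃ (Cb : ℝ) (CG₁ CG₂ : Fin 2 → ℝ), ∀ k : ℝ, 0 < k →
      AbstractWave.AbstractAssumption (HPEC Ω) (ipPEC Ω k) (Dcurl Ω k (HPEC Ω)) (fun _ _ => 0)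
        (fun ℓ => mulOp Ω (μinv ℓ)) (fun ℓ => mulOp Ω (ε ℓ)) Cb CG₁ CG₂ := by
  choose A hA hA' using fun ℓ => exists_clm_eq_mulOp (hμ ℓ).bounded
  choose B hB _ using fun ℓ => exists_clm_eq_mulOp (hε ℓ).bounded
  choose c hc hcA using fun ℓ => (hμ ℓ).le_re_inner
  simp only [← hA, ← hB]
  -- PEC is the degenerate case `τ = 0`, `Θ = 0` of the graph framework.
  refine ⟨‖(0 : L2bd Ω →L[ℂ] L2bd Ω)‖, c, fun ℓ => ‖B ℓ‖ + c ℓ, fun k hk => ?_⟩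
  refine AbstractWave.AbstractAssumption.of_graph (DcurlLM hΩ.isOpen k HPEC_exists_trace)
    (0 : HPEC Ω →ₗ[ℂ] L2bd Ω) 0 A B (dense_of_hasTangentialTrace_zero hΩ.isOpen fun v hv => hv)
    (fun v x y z hx hy hz => ?_) (fun u v => ?_) (fun u v => ?_) hc
    (fun ℓ => add_pos_of_nonneg_of_pos (norm_nonneg _) (hc ℓ)) fun ℓ v => ?_
  · have hcurl := tendsto_curl_of_tendsto_Dcurl hk hx
    have hw : HasTangentialTrace Ω y 0 :=
      .of_tendsto hΩ hy hcurl tendsto_const_nhds fun n => (v n).2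
    refine ⟨⟨y, hw⟩, Dcurl_eq_of_curl_eq hk ?_, rfl, tendsto_nhds_unique tendsto_const_nhds hz⟩
    exact (HasWeakCurl.of_tendsto hy hcurl fun n =>
      HasTangentialTrace.hasWeakCurl hΩ.isOpen (v n).2).curl_eq hΩ.isOpen
  · simp [ipPEC, DcurlLM]
  · simp
  · have hY : ‖inner ℂ (v : L2 Ω) (B ℓ v)‖ ≤ ‖B ℓ‖ * ‖(v : L2 Ω)‖ ^ 2 := by
      refine (norm_inner_le_norm _ _).trans ?_
      rw [sq, mul_left_comm]
      gcongr
      exact (B ℓ).le_opNorm _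
    have := AbstractWave.garding_of_re_le
      (hcA ℓ (DcurlLM hΩ.isOpen k HPEC_exists_trace v) _ (hA' ℓ _)) hY
    simpa using this

set_option maxHeartbeats 1600000 in
theorem abstractAssumption_impedance {Ω Γ : Set E3} (hΩ : IsBoundedLipschitzOpen Ω)
    (hΓ : MeasurableSet Γ) {μinv ε : Fin 2 → E3 → Matrix (Fin 3) (Fin 3) ℂ}
    (hμ : ∀ ℓ, IsCoefficient Ω (μinv ℓ)) (hε : ∀ ℓ, IsCoefficient Ω (ε ℓ))
    {θ : E3 → ℝ} (hθ : MemLp θ ∞ ((surf Ω).restrict Γ))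
    (hθ' : ∃ c : ℝ, 0 < c ∧ ∀ᵐ x ∂((surf Ω).restrict Γ), c ≤ θ x)
    (hμr : ∀ ℓ, IsRealValued Ω (μinv ℓ)) (hεr : ∀ ℓ, IsRealValued Ω (ε ℓ)) :
    ∃ (Cb : ℝ) (CG₁ CG₂ : Fin 2 → ℝ), ∀ k : ℝ, 0 < k →
      AbstractWave.AbstractAssumption (Himp Ω Γ) (ipImp Ω Γ k) (Dcurl Ω k (Himp Ω Γ))
        (bImp Ω Γ k θ) (fun ℓ => mulOp Ω (μinv ℓ)) (fun ℓ => mulOp Ω (ε ℓ)) Cb CG₁ CG₂ := by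
  choose A hA hA' using fun ℓ => exists_clm_eq_mulOp (hμ ℓ).bounded
  choose B hB hB' using fun ℓ => exists_clm_eq_mulOp (hε ℓ).bounded
  choose c hc hcA using fun ℓ => (hμ ℓ).le_re_inner
  obtain ⟨Θ, hΘ⟩ := exists_clm_real_smul ((memLp_indicator_iff_restrict hΓ).2 hθ)
  obtain ⟨c', hc', hcθ⟩ := hθ'
  simp only [← hA, ← hB]
  -- All constants are fixed before `k` is introduced.
  refine ⟨‖Θ‖, fun ℓ => min (c ℓ) c' / 2, fun ℓ => ‖B ℓ‖ + c ℓ, fun k hk => ?_⟩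
  set r : ℝ := √k⁻¹
  have hr : r * r = k⁻¹ := Real.mul_self_sqrt (by positivity)
  have hr0 : r ≠ 0 := by positivity
  obtain ⟨D, hD⟩ : ∃ D : Himp Ω Γ →ₗ[ℂ] L2 Ω, Dcurl Ω k (Himp Ω Γ) = D :=
    ⟨DcurlLM hΩ.isOpen k Himp_exists_trace, rfl⟩
  obtain ⟨τ, hτ⟩ : ∃ τ : Himp Ω Γ →ₗ[ℂ] L2bd Ω, ∀ v, τ v = (r : ℂ) • tangTrace Ω (v : L2 Ω) :=
    ⟨traceLM hΩ r Himp_exists_trace, fun _ => rfl⟩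
  rw [hD]
  refine AbstractWave.AbstractAssumption.of_graph D τ Θ A B
    (dense_of_hasTangentialTrace_zero hΩ.isOpen fun v hv => ⟨0, hv, ?_⟩)
    (fun v x y z hx hy hz => ?_) (fun u v => ?_) (fun u v => ?_)
    (fun ℓ => half_pos (lt_min (hc ℓ) hc'))
    (fun ℓ => add_pos_of_nonneg_of_pos (norm_nonneg _) (hc ℓ)) fun ℓ v => ?_
  · exact ae_restrict_of_ae ((Lp.coeFn_zero C3 2 (surf Ω)).mono fun x hx => by simpa using hx)
  · rw [← hD] at hx ⊢
    have hcurl := tendsto_curl_of_tendsto_Dcurl hk hx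
    have hrz : (r : ℂ) • ((r⁻¹ : ℝ) : ℂ) • z = z := by
      rw [smul_smul, ← Complex.ofReal_mul, mul_inv_cancel₀ hr0, Complex.ofReal_one, one_smul]
    -- Closedness concerns the unscaled trace, so the factor `r` in `τ` is divided out.
    have htr : Tendsto (fun n => tangTrace Ω (v n : L2 Ω)) atTop (𝓝 (((r⁻¹ : ℝ) : ℂ) • z)) := by
      refine (hz.const_smul ((r⁻¹ : ℝ) : ℂ)).congr fun n => ?_
      rw [hτ, smul_smul, ← Complex.ofReal_mul, inv_mul_cancel₀ hr0, Complex.ofReal_one, one_smul]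
    have htrace : ∀ n, HasTangentialTrace Ω (v n : L2 Ω) (tangTrace Ω (v n : L2 Ω)) := by
      intro n
      obtain ⟨g, hg, -⟩ := (v n).2
      rwa [hg.tangTrace_eq hΩ]
    have hw : HasTangentialTrace Ω y (((r⁻¹ : ℝ) : ℂ) • z) := .of_tendsto hΩ hy hcurl htr htrace
    refine ⟨⟨y, _, hw, ae_eq_zero_of_tendsto htr fun n => ?_⟩, Dcurl_eq_of_curl_eq hk ?_, rfl, ?_⟩
    · exact (ae_restrict_iff' hΓ.compl).2 (tangTrace_ae_eq_zero hΩ hΓ (v n))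
    · exact (HasWeakCurl.of_tendsto hy hcurl fun n =>
        (htrace n).hasWeakCurl hΩ.isOpen).curl_eq hΩ.isOpen
    · rw [hτ]
      exact (congrArg _ (hw.tangTrace_eq hΩ)).trans hrz
  · rw [hτ u, hτ v, ← hD]
    exact ipImp_eq hΩ hΓ hr u v
  · rw [hτ u, hτ v]
    exact bImp_eq hΓ hr hΘ u v
  · have hY : ‖inner ℂ (v : L2 Ω) (B ℓ v)‖ ≤ ‖B ℓ‖ * ‖(v : L2 Ω)‖ ^ 2 := by
      refine (norm_inner_le_norm _ _).trans ?_
      rw [sq, mul_left_comm]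
      gcongr
      exact (B ℓ).le_opNorm _
    refine AbstractWave.garding_of_im_eq_zero (by positivity) (by positivity) (by positivity)
      (hcA ℓ (D v) _ (hA' ℓ _)) ((hμ ℓ).im_inner (hμr ℓ) (hA' ℓ _)) hY
      ((hε ℓ).im_inner (hεr ℓ) (hB' ℓ _)) (le_re_inner_of_ae ?_) (im_inner_eq_zero_of_ae ?_)
    · filter_upwards [hΘ (τ v), (ae_restrict_iff' hΓ).1 hcθ, tangTrace_ae_eq_zero hΩ hΓ v,
        Lp.coeFn_smul (r : ℂ) (tangTrace Ω (v : L2 Ω))] with x hx hcx h0 hs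
      rw [hx, inner_smul_right, inner_self_eq_norm_sq_to_K, Complex.re_ofReal_mul]
      -- The lower bound on `θ` is available only on `Γ`; elsewhere the trace is zero and both sides
      -- vanish.
      by_cases hxΓ : x ∈ Γ
      · rw [indicator_of_mem hxΓ]
        norm_cast
        exact mul_le_mul_of_nonneg_right (hcx hxΓ) (by positivity)
      · have hτ0 : τ v x = 0 := by rw [hτ, hs, Pi.smul_apply, h0 hxΓ, smul_zero]
        simp [hτ0]
    · filter_upwards [hΘ (τ v)] with x hx
      rw [hx, inner_smul_right, Complex.im_ofReal_mul]
      have h0 : (inner ℂ (τ v x) (τ v x) : ℂ).im = 0 := inner_self_im (𝕜 := ℂ) (τ v x)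
      rw [h0, mul_zero]

end Maxwell

end

theorem lemma2p4 (Ω : Set Maxwell.E3) (hΩ : Maxwell.IsBoundedLipschitzOpen Ω)
    (μinv ε : Fin 2 → Maxwell.E3 → Matrix (Fin 3) (Fin 3) ℂ)
    (hμ : ∀ ℓ, Maxwell.IsCoefficient Ω (μinv ℓ)) (hε : ∀ ℓ, Maxwell.IsCoefficient Ω (ε ℓ)) :
    -- (i) the PEC problem
    (∃ (Cb : ℝ) (CG₁ CG₂ : Fin 2 → ℝ), ∀ k : ℝ, 0 < k →
      AbstractWave.AbstractAssumption (Maxwell.HPEC Ω) (Maxwell.ipPEC Ω k)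
        (Maxwell.Dcurl Ω k (Maxwell.HPEC Ω)) (fun _ _ => 0)
        (fun ℓ => Maxwell.mulOp Ω (μinv ℓ)) (fun ℓ => Maxwell.mulOp Ω (ε ℓ)) Cb CG₁ CG₂) ∧
    -- (ii) the impedance problem
    (∀ Γ : Set Maxwell.E3, Maxwell.IsBoundaryComponent Ω Γ →
      ∀ θ : Maxwell.E3 → ℝ, MemLp θ ∞ ((Maxwell.surf Ω).restrict Γ) →
      (∃ c : ℝ, 0 < c ∧ ∀ᵐ x ∂((Maxwell.surf Ω).restrict Γ), c ≤ θ x) →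
      (∀ ℓ, Maxwell.IsRealValued Ω (μinv ℓ)) → (∀ ℓ, Maxwell.IsRealValued Ω (ε ℓ)) →
      ∃ (Cb : ℝ) (CG₁ CG₂ : Fin 2 → ℝ), ∀ k : ℝ, 0 < k →
        AbstractWave.AbstractAssumption (Maxwell.Himp Ω Γ) (Maxwell.ipImp Ω Γ k)
          (Maxwell.Dcurl Ω k (Maxwell.Himp Ω Γ)) (Maxwell.bImp Ω Γ k θ)
          (fun ℓ => Maxwell.mulOp Ω (μinv ℓ)) (fun ℓ => Maxwell.mulOp Ω (ε ℓ)) Cb CG₁ CG₂) := by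
  refine ⟨Maxwell.abstractAssumption_PEC hΩ hμ hε, fun Γ hΓ θ hθ hθ' hμr hεr => ?_⟩
  -- A connected component of the closed set `∂Ω` is closed, hence measurable.
  exact Maxwell.abstractAssumption_impedance hΩ hΓ.isClosed.measurableSet hμ hε hθ hθ' hμr hεr
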